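/- Let $X=\begin{pmatrix}0&1\\1&0\end{pmatrix}$ and $Z=\begin{pmatrix}1&0\\0&-1\end{pmatrix}$, and for $1\le i\le n$ let $X_i,Z_i$ denote the operators on $(\mathbb C^2)^{\otimes n}$ acting as $X,Z$ on the $i$-th tensor factor and as the identity on the others. Let $n_B\ge 0$ and let $H_B$ be a Hermitian operator on $(\mathbb C^2)^{\otimes n_B}$, with eigenvalues $E^{(B)}_1,\dots,E^{(B)}_{2^{n_B}}$ (with multiplicity), such that $$\min_{i\ne j}|E^{(B)}_i-E^{(B)}_j|>0\quad\text{and}\quad \min_{i,j}|E^{(B)}_i+E^{(B)}_j|>0 .$$ Let $(h_i)_{i>n_B}$, $(g_i)_{i>n_B}$ be random variables on a probability space, all mutually independent and uniformly distributed on $[-\tfrac12,\tfrac12]$. For $\alpha\ge 0$ and $n\ge n_B$ consider on $(\mathbb C^2)^{\otimes n}$ the random Hamiltonian $$H_n=H_B+\sum_{i=n_B+1}^{n}\left(h_iZ_i+\alpha^i g_i X_1X_i\right),$$ where $H_B$ acts on the first $n_B$ factors, and let $E_1\le E_2\le\dots\le E_{2^n}$ be its eigenvalues, repeated according to multiplicity.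 Fix $\theta\in(2/3,1)$. Let $\mathcal P_n$ be the partition of $\{1,\dots,2^n\}$ into resonant patches: the partition into sets of consecutive indices in which $i$ and $i+1$ belong to the same patch if and only if $E_{i+1}-E_i\le\alpha^{\theta n}$. Let $\mathcal P_{n,1}\subset\mathcal P_n$ be the set of patches that consist of exactly one index. Theorem. For every $\theta\in(2/3,1)$ there is $\alpha_0\in(0,1/2)$, depending only on $\theta$, such that for all $n_B$ and $H_B$ as above and all $0\le\alpha\le\alpha_0$, $$\frac{|\mathcal P_{n,1}|}{2^n}\longrightarrow 1\qquad\text{almost surely, as } n\to\infty .$$ -/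

import Mathlib

open MeasureTheory ProbabilityTheory Filter Topology

namespace QuantumSun

/-! ### Spins and operators -/

/-- Configurations of `n` spins, labelling the standard basis of the `n`-fold tensor power of `ℂ²`.
The value `0` is the eigenvalue `+1` of the Pauli matrix `Z`, the value `1` is the eigenvalue `-1`.
The site `i + 1` of the chain is `i : Fin n`. -/
abbrev Config (n : ℕ) : Type := Fin n → Fin 2

/-- Operators on the `n`-fold tensor power of `ℂ²`, as matrices in the standard basis. -/
abbrev Op (n : ℕ) : Type := Matrix (Config n) (Config n) ℂ

/-- The Pauli matrix `X`. -/
def pauliX : Matrix (Fin 2) (Fin 2) ℂ := !![0, 1; 1, 0]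

/-- The Pauli matrix `Z`. -/
def pauliZ : Matrix (Fin 2) (Fin 2) ℂ := !![1, 0; 0, -1]

/-- The tensor product of the one-spin operators `A 0, …, A (n - 1)`. -/
def tensorOp {n : ℕ} (A : Fin n → Matrix (Fin 2) (Fin 2) ℂ) : Op n :=
  fun σ τ => ∏ j, A j (σ j) (τ j)

/-- The operator that acts as `A` on the spin `i` and as the identity on the other spins. -/
def siteOp {n : ℕ} (i : Fin n) (A : Matrix (Fin 2) (Fin 2) ℂ) : Op n :=
  tensorOp (fun j => if j = i then A else 1)

/-- An operator on the first `nB` spins, seen as an operator on `nB + m` spins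
(it acts as the identity on the last `m` spins). -/
def bathOp {nB : ℕ} (m : ℕ) (HB : Op nB) : Op (nB + m) :=
  fun σ τ =>
    if ∀ j : Fin m, σ (Fin.natAdd nB j) = τ (Fin.natAdd nB j) then
      HB (fun i => σ (Fin.castAdd m i)) (fun i => τ (Fin.castAdd m i))
    else 0

/-- The Hamiltonian `H_n` of the quantum sun model on `n = nB + m` spins:
`H_B + ∑_{i = nB + 1}^{n} (h_i Z_i + α ^ i g_i X_1 X_i)`.
The summand of `j : Fin m` belongs to the site `i = nB + j + 1`, and the entries `h j`, `g j` of the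
sequences `h` and `g` are the parameters `h_i`, `g_i` of that site. -/
def hamiltonian {nB : ℕ} (HB : Op nB) (α : ℝ) (h g : ℕ → ℝ) (m : ℕ) : Op (nB + m) :=
  bathOp m HB + ∑ j : Fin m,
    (((h j : ℝ) : ℂ) • siteOp (Fin.natAdd nB j) pauliZ +
      ((α ^ (nB + (j : ℕ) + 1) * g j : ℝ) : ℂ) •
        (siteOp ⟨0, Nat.lt_of_le_of_lt (Nat.zero_le _) (Fin.natAdd nB j).isLt⟩ pauliX *
          siteOp (Fin.natAdd nB j) pauliX))

/-! ### The Hamiltonian is Hermitian -/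

theorem tensorOp_mul {n : ℕ} (A B : Fin n → Matrix (Fin 2) (Fin 2) ℂ) :
    tensorOp A * tensorOp B = tensorOp (fun j => A j * B j) := by
  ext σ τ
  simp only [Matrix.mul_apply, tensorOp]
  rw [Finset.prod_univ_sum]
  simp [Fintype.piFinset_univ, Finset.prod_mul_distrib]

theorem tensorOp_isHermitian {n : ℕ} (A : Fin n → Matrix (Fin 2) (Fin 2) ℂ)
    (hA : ∀ j, (A j).IsHermitian) : (tensorOp A).IsHermitian := by
  ext σ τ
  simp only [Matrix.conjTranspose_apply, tensorOp, star_prod]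
  exact Finset.prod_congr rfl fun j _ => (hA j).apply _ _

theorem siteOp_isHermitian {n : ℕ} (i : Fin n) {A : Matrix (Fin 2) (Fin 2) ℂ}
    (hA : A.IsHermitian) : (siteOp i A).IsHermitian := by
  refine tensorOp_isHermitian _ fun j => ?_
  split_ifs
  · exact hA
  · exact Matrix.isHermitian_one

theorem pauliX_isHermitian : pauliX.IsHermitian := by
  ext i j
  fin_cases i <;> fin_cases j <;> simp [pauliX]

theorem pauliZ_isHermitian : pauliZ.IsHermitian := by
  ext i j
  fin_cases i <;> fin_cases j <;> simp [pauliZ]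

theorem siteOp_mul_comm {n : ℕ} (i k : Fin n) (A : Matrix (Fin 2) (Fin 2) ℂ) :
    siteOp i A * siteOp k A = siteOp k A * siteOp i A := by
  unfold siteOp
  rw [tensorOp_mul, tensorOp_mul]
  congr 1
  funext j
  split_ifs <;> simp

theorem bathOp_isHermitian {nB : ℕ} (m : ℕ) {HB : Op nB} (hHB : HB.IsHermitian) :
    (bathOp m HB).IsHermitian := by
  ext σ τ
  simp only [Matrix.conjTranspose_apply, bathOp]
  by_cases hst : ∀ j : Fin m, σ (Fin.natAdd nB j) = τ (Fin.natAdd nB j)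
  · rw [if_pos hst, if_pos fun j => (hst j).symm]
    exact hHB.apply _ _
  · rw [if_neg hst, if_neg fun hts => hst fun j => (hts j).symm, star_zero]

theorem isHermitian_real_smul {n : ℕ} (c : ℝ) {A : Op n} (hA : A.IsHermitian) :
    ((c : ℂ) • A).IsHermitian := by
  unfold Matrix.IsHermitian
  rw [Matrix.conjTranspose_smul, hA.eq]
  simp

theorem hamiltonian_isHermitian {nB : ℕ} {HB : Op nB} (hHB : HB.IsHermitian) (α : ℝ)
    (h g : ℕ → ℝ) (m : ℕ) : (hamiltonian HB α h g m).IsHermitian := by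
  refine (bathOp_isHermitian m hHB).add ?_
  unfold Matrix.IsHermitian
  rw [Matrix.conjTranspose_sum]
  refine Finset.sum_congr rfl fun j _ => ?_
  refine Matrix.IsHermitian.add (isHermitian_real_smul _ (siteOp_isHermitian _ pauliZ_isHermitian))
    (isHermitian_real_smul _ ?_)
  unfold Matrix.IsHermitian
  rw [Matrix.conjTranspose_mul, (siteOp_isHermitian _ pauliX_isHermitian).eq,
    (siteOp_isHermitian _ pauliX_isHermitian).eq, siteOp_mul_comm]

/-! ### Eigenvalues -/

theorem card_config (n : ℕ) : 2 ^ n = Fintype.card (Config n) := by simp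

/-- The eigenvalues of a Hermitian operator on `n` spins, repeated according to multiplicity and
indexed in increasing order (`Matrix.IsHermitian.eigenvalues₀` is indexed in decreasing order). -/
noncomputable def levels {n : ℕ} {A : Op n} (hA : A.IsHermitian) : Fin (2 ^ n) → ℝ :=
  fun i => hA.eigenvalues₀ (Fin.cast (card_config n) i.rev)

theorem levels_monotone {n : ℕ} {A : Op n} (hA : A.IsHermitian) : Monotone (levels hA) := by
  intro i j hij
  refine hA.eigenvalues₀_antitone ?_
  simpa [Fin.le_def] using Fin.rev_le_rev.mpr hij

/-- The assumption on the bath: its spectrum is non-degenerate and non-anti-degenerate. -/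
def NonDegenerate {nB : ℕ} {HB : Op nB} (hHB : HB.IsHermitian) : Prop :=
  (∀ i j, i ≠ j → 0 < |levels hHB i - levels hHB j|) ∧
    ∀ i j, 0 < |levels hHB i + levels hHB j|

/-! ### Resonant patches -/

/-- Two indices are in the same resonant patch of the increasingly ordered levels `E` iff every gap
between consecutive levels from one to the other is at most `ε`. -/
def patchSetoid {N : ℕ} (E : Fin N → ℝ) (ε : ℝ) : Setoid (Fin N) where
  r i j := ∀ k l : Fin N, (k : ℕ) + 1 = l → min i j ≤ k → l ≤ max i j → E l - E k ≤ ε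
  iseqv :=
    { refl := by
        intro i k l hkl h1 h2
        rw [min_self] at h1
        rw [max_self] at h2
        rw [Fin.le_def] at h1 h2
        omega
      symm := by
        intro i j hij k l hkl h1 h2
        exact hij k l hkl (by rwa [min_comm]) (by rwa [max_comm])
      trans := by
        intro i j p hij hjp k l hkl h1 h2
        have hor : (min i j ≤ k ∧ l ≤ max i j) ∨ (min j p ≤ k ∧ l ≤ max j p) := by
          simp only [min_le_iff, le_max_iff, Fin.le_def] at h1 h2 ⊢
          omega
        rcases hor with hor | hor
        · exact hij k l hkl hor.1 hor.2
        · exact hjp k l hkl hor.1 hor.2 }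

open Classical in
/-- The partition of the index set into resonant patches, for the resonance threshold `ε`. -/
noncomputable def patches {N : ℕ} (E : Fin N → ℝ) (ε : ℝ) : Finset (Finset (Fin N)) :=
  (Finpartition.ofSetoid (patchSetoid E ε)).parts

/-- The resonant patches that have exactly `k` levels. -/
noncomputable def patchesOfSize {N : ℕ} (E : Fin N → ℝ) (ε : ℝ) (k : ℕ) :
    Finset (Finset (Fin N)) :=
  (patches E ε).filter fun p => p.card = k

end QuantumSun

namespace QuantumSun

/-! ### Growth and zeros of polynomials that are bounded on a real interval -/

section PolynomialGrowth

open Polynomial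

/-! Write n for the current number of spins and split `α = a * q ^ 6` with `a = α ^ θ`, so that `a ^
n` is the resonance threshold and `q ^ 6` is what remains of the coupling once the threshold is
taken out. An index that lies in no pair of levels at distance at most `a ^ n` is a patch by itself,
so it suffices that the number of such close pairs is almost surely o(2^n). The quantity to follow
is `closeCost`, the sum of -log|E_i - E_j| over the close pairs: each of them contributes at least n
log(1/a) ≥ n, hence a mean cost of order 2^n √n leaves a fraction of close pairs of order 1/√n.

Let one spin be added. At zero coupling each level E splits into E ± h, and unless h is resonant
with some transition, the close pairs and their cost exactly double (`sum_closePairs_of_split`).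
Resonances have probability at most 2^(-n) and stop by Borel–Cantelli (`ae_eventually_nonResonant`).
When the coupling g is switched on, the new cost is at most the old one plus the drop of the log of
the discriminant, up to a small error (`closeCost_le_of_abs_sub_le`). The modulus of the
discriminant is that of a polynomial in g of degree at most 2·4^(n+1), since the discriminant is a
determinant of traces of powers of the Hamiltonian (`exists_discriminant_polynomial`). By Weyl's
inequality it grows by at most exp(cost + O(1)) on the very long interval |g| ≤ q^(-3n); the
Joukowski map carries such a bound to a disk, and a Jensen-type estimate then leaves only O((cost +
1)/n) zeros near the origin. Each of these lowers the logarithm by at most 3 on average over g, and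
the far zeros together by little (`lintegral_log_norm_eval_le`).

So, conditionally on the past, the mean cost after the step is at most 2(1 + 1/(4n)) cost + 3
(`lintegral_closeCost_succ_le`), and iteration gives the order 2^n √n. The bound 1/√n on the mean
density is not summable, but along non-resonant steps the density of close pairs never increases
(`regularDensity_succ_le`), and a decreasing sequence with means tending to 0 tends to 0 almost
surely. -/

theorem norm_eval_joukowski_mul_pow_le {p : ℂ[X]} {d : ℕ} (hd : p.natDegree ≤ d) {R M : ℝ}
    (hR : 0 ≤ R) (hM : ∀ x : ℝ, |x| ≤ R → ‖p.eval (x : ℂ)‖ ≤ M) {w : ℂ} (hw0 : w ≠ 0)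
    (hw : ‖w‖ ≤ 1) : ‖p.eval ((R : ℂ) * (w + w⁻¹) / 2)‖ * ‖w‖ ^ d ≤ M := by
  -- The factor `w ^ d` clears the pole at the origin, so this is a polynomial in `w`. On the unit
  -- circle the Joukowski image is the real number `R * Re w`, where the hypothesis applies; the
  -- maximum principle does the rest.
  set f : ℂ → ℂ := fun w => ∑ j ∈ Finset.range (d + 1),
    p.coeff j * ((R : ℂ) / 2 * (w ^ 2 + 1)) ^ j * w ^ (d - j) with hf
  have hfw : ∀ w : ℂ, w ≠ 0 → f w = p.eval ((R : ℂ) * (w + w⁻¹) / 2) * w ^ d := by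
    intro w hw
    rw [Polynomial.eval_eq_sum_range' (Nat.lt_succ_of_le hd), Finset.sum_mul]
    refine Finset.sum_congr rfl fun j hj => ?_
    have hjd : j ≤ d := Nat.lt_succ_iff.mp (Finset.mem_range.mp hj)
    have h1 : w ^ d = w ^ j * w ^ (d - j) := by rw [← pow_add, Nat.add_sub_cancel' hjd]
    have h2 : (R : ℂ) / 2 * (w ^ 2 + 1) = ((R : ℂ) * (w + w⁻¹) / 2) * w := by
      field_simp
    rw [h1, h2, mul_pow]
    ring
  have hdiff : Differentiable ℂ f := by
    rw [hf]; fun_prop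
  have hbd : ∀ z ∈ frontier (Metric.ball (0 : ℂ) 1), ‖f z‖ ≤ M := by
    intro z hz
    rw [frontier_ball _ one_ne_zero, mem_sphere_zero_iff_norm] at hz
    have hz0 : z ≠ 0 := by
      rintro rfl
      simp at hz
    have hinv : z⁻¹ = (starRingEnd ℂ) z := by
      rw [Complex.inv_def, Complex.normSq_eq_norm_sq, hz]
      simp
    have hre : (R : ℂ) * (z + z⁻¹) / 2 = ((R * z.re : ℝ) : ℂ) := by
      rw [hinv, Complex.add_conj]
      push_cast
      ring
    rw [hfw z hz0, norm_mul, norm_pow, hz, one_pow, mul_one, hre]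
    apply hM
    rw [abs_mul, abs_of_nonneg hR]
    have := Complex.abs_re_le_norm z
    rw [hz] at this
    nlinarith
  have hcl : w ∈ closure (Metric.ball (0 : ℂ) 1) := by
    rw [closure_ball _ one_ne_zero]
    simpa using hw
  have := Complex.norm_le_of_forall_mem_frontier_norm_le Metric.isBounded_ball
    hdiff.diffContOnCl hbd hcl
  rwa [hfw w hw0, norm_mul, norm_pow] at this

/-- The two solutions ζ ± s, with s² = ζ² - 1, are inverse to each other, so one of them lies in the
closed unit disk. It is close to the unit circle because (|w| + 2ε)|w| ≥ 1 forces |w| + ε ≥ 1. -/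
theorem exists_joukowski_preimage (ζ : ℂ) {ε : ℝ} (hζ : ‖ζ‖ ≤ ε) :
    ∃ w : ℂ, w ≠ 0 ∧ ‖w‖ ≤ 1 ∧ 1 - ε ≤ ‖w‖ ∧ w + w⁻¹ = 2 * ζ := by
  obtain ⟨s, hs⟩ := IsAlgClosed.exists_pow_nat_eq (ζ ^ 2 - 1) (n := 2) (by norm_num)
  have hprod : (ζ + s) * (ζ - s) = 1 := by linear_combination -hs
  have key : ∃ w : ℂ, w ≠ 0 ∧ ‖w‖ ≤ 1 ∧ w + w⁻¹ = 2 * ζ := by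
    have h1 : ζ + s ≠ 0 := left_ne_zero_of_mul_eq_one hprod
    have h2 : ζ - s ≠ 0 := right_ne_zero_of_mul_eq_one hprod
    have i1 : (ζ + s)⁻¹ = ζ - s := inv_eq_of_mul_eq_one_right hprod
    have i2 : (ζ - s)⁻¹ = ζ + s := inv_eq_of_mul_eq_one_left hprod
    have hn : ‖ζ + s‖ * ‖ζ - s‖ = 1 := by rw [← norm_mul, hprod, norm_one]
    rcases le_total ‖ζ + s‖ 1 with h | h
    · exact ⟨ζ + s, h1, h, by rw [i1]; ring⟩
    · refine ⟨ζ - s, h2, ?_, by rw [i2]; ring⟩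
      nlinarith [norm_nonneg (ζ - s)]
  obtain ⟨w, hw0, hw1, hw⟩ := key
  refine ⟨w, hw0, hw1, ?_, hw⟩
  have hpos : 0 < ‖w‖ := norm_pos_iff.mpr hw0
  have hle : ‖w‖⁻¹ ≤ 2 * ε + ‖w‖ := by
    have : w⁻¹ = 2 * ζ - w := by rw [← hw]; ring
    calc ‖w‖⁻¹ = ‖w⁻¹‖ := (norm_inv w).symm
      _ ≤ ‖2 * ζ‖ + ‖w‖ := by rw [this]; exact norm_sub_le _ _
      _ ≤ 2 * ε + ‖w‖ := by rw [norm_mul]; simp; linarith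
  have h1 : 1 ≤ (2 * ε + ‖w‖) * ‖w‖ := by
    rwa [inv_le_iff_one_le_mul₀ hpos] at hle
  by_contra! hlt
  nlinarith [norm_nonneg ζ]

theorem exp_neg_two_mul_le_one_sub {ε : ℝ} (h0 : 0 ≤ ε) (h1 : ε ≤ 1 / 2) :
    Real.exp (-(2 * ε)) ≤ 1 - ε := by
  rw [Real.exp_neg, inv_le_comm₀ (Real.exp_pos _) (by linarith)]
  have h2 := Real.add_one_le_exp (2 * ε)
  refine le_trans ?_ h2
  rw [inv_le_iff_one_le_mul₀ (by linarith)]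
  nlinarith

/-- A polynomial that is bounded on a real interval is bounded on a much smaller disk. -/
theorem norm_eval_le_of_bounded_on_interval {p : ℂ[X]} {d : ℕ} (hd : p.natDegree ≤ d) {R M ε : ℝ}
    (hR : 0 < R) (hM : ∀ x : ℝ, |x| ≤ R → ‖p.eval (x : ℂ)‖ ≤ M) (hε0 : 0 ≤ ε) (hε : ε ≤ 1 / 2)
    {z : ℂ} (hz : ‖z‖ ≤ ε * R) : ‖p.eval z‖ ≤ M * Real.exp (2 * d * ε) := by
  have hζ : ‖z / R‖ ≤ ε := by
    rw [norm_div, Complex.norm_real, Real.norm_of_nonneg hR.le, div_le_iff₀ hR]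
    exact hz
  obtain ⟨w, hw0, hw1, hwε, hw⟩ := exists_joukowski_preimage (z / R) hζ
  have h1 := norm_eval_joukowski_mul_pow_le hd hR.le hM hw0 hw1
  have hRC : (R : ℂ) ≠ 0 := by exact_mod_cast hR.ne'
  have h2 : (R : ℂ) * (w + w⁻¹) / 2 = z := by
    rw [hw]
    field_simp
  rw [h2] at h1
  have h3 : Real.exp (-(2 * d * ε)) ≤ ‖w‖ ^ d := by
    have : Real.exp (-(2 * d * ε)) = Real.exp (-(2 * ε)) ^ d := by
      rw [← Real.exp_nat_mul]
      ring_nf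
    rw [this]
    exact pow_le_pow_left₀ (Real.exp_pos _).le
      ((exp_neg_two_mul_le_one_sub hε0 hε).trans hwε) d
  have h4 : ‖p.eval z‖ * Real.exp (-(2 * d * ε)) ≤ M :=
    (mul_le_mul_of_nonneg_left h3 (norm_nonneg _)).trans h1
  rw [Real.exp_neg, ← div_eq_mul_inv, div_le_iff₀ (Real.exp_pos _)] at h4
  exact h4

theorem norm_multiset_prod_map {s : Multiset ℂ} (f : ℂ → ℂ) :
    ‖(s.map f).prod‖ = (s.map fun a => ‖f a‖).prod := by
  induction s using Multiset.induction with
  | empty => simp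
  | cons a s ih => simp [ih]

theorem pow_card_le_multiset_prod {s : Multiset ℂ} {f : ℂ → ℝ} {c : ℝ} (hc : 0 ≤ c)
    (h : ∀ a ∈ s, c ≤ f a) : c ^ s.card ≤ (s.map f).prod := by
  induction s using Multiset.induction with
  | empty => simp
  | cons a s ih =>
    simp only [Multiset.map_cons, Multiset.prod_cons, Multiset.card_cons]
    rw [pow_succ']
    exact mul_le_mul (h a (Multiset.mem_cons_self a s))
      (ih fun b hb => h b (Multiset.mem_cons_of_mem hb)) (pow_nonneg hc _)
      (hc.trans (h a (Multiset.mem_cons_self a s)))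

theorem multiset_prod_le_pow_card {s : Multiset ℂ} {f : ℂ → ℝ} {c : ℝ}
    (h0 : ∀ a ∈ s, 0 ≤ f a) (h : ∀ a ∈ s, f a ≤ c) : (s.map f).prod ≤ c ^ s.card := by
  induction s using Multiset.induction with
  | empty => simp
  | cons a s ih =>
    simp only [Multiset.map_cons, Multiset.prod_cons, Multiset.card_cons]
    rw [pow_succ']
    have hf := h0 a (Multiset.mem_cons_self a s)
    refine mul_le_mul (h a (Multiset.mem_cons_self a s))
      (ih (fun b hb => h0 b (Multiset.mem_cons_of_mem hb))
        fun b hb => h b (Multiset.mem_cons_of_mem hb)) ?_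
      (hf.trans (h a (Multiset.mem_cons_self a s)))
    refine Multiset.prod_nonneg ?_
    intro x hx
    obtain ⟨b, hb, rfl⟩ := Multiset.mem_map.mp hx
    exact h0 b (Multiset.mem_cons_of_mem hb)

/-- A bound on the number of zeros in a disk by the growth in a larger one. -/
theorem pow_card_roots_le {p : ℂ[X]} (hp0 : p.eval 0 ≠ 0) {r y M : ℝ} (hr : 0 < r) (hry : r < y)
    (hM : ∀ z : ℂ, ‖z‖ ≤ y → ‖p.eval z‖ ≤ M * ‖p.eval 0‖) :
    (y / r - 1) ^ (p.roots.filter fun z => ‖z‖ ≤ r).card ≤ M := by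
  set s := p.roots.filter fun z => ‖z‖ ≤ r with hs
  have hsr : ∀ a ∈ s, ‖a‖ ≤ r := fun a ha => (Multiset.mem_filter.mp ha).2
  have hdvd : (s.map fun a => X - C a).prod ∣ p :=
    (Multiset.prod_dvd_prod_of_le (Multiset.map_le_map (Multiset.filter_le _ _))).trans
      p.prod_multiset_X_sub_C_dvd
  -- The quotient by the zeros in the small disk satisfies the maximum principle on the large one.
  -- Linear factors instead of Blaschke factors give the base `y / r - 1` in place of `y / r`, which
  -- is harmless here.
  obtain ⟨Q, hQ⟩ := hdvd
  have heval : ∀ z : ℂ, p.eval z = (s.map fun a => z - a).prod * Q.eval z := by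
    intro z
    conv_lhs => rw [hQ]
    rw [eval_mul, eval_multiset_prod, Multiset.map_map]
    simp
  have hpos : 0 < ‖p.eval 0‖ := norm_pos_iff.mpr hp0
  have hfr : ∀ z ∈ frontier (Metric.ball (0 : ℂ) y),
      ‖Q.eval z‖ ≤ M * ‖p.eval 0‖ / (y - r) ^ s.card := by
    intro z hz
    rw [frontier_ball _ (by linarith), mem_sphere_zero_iff_norm] at hz
    rw [le_div_iff₀ (pow_pos (by linarith) _)]
    refine le_trans ?_ (hM z hz.le)
    rw [heval z, norm_mul, mul_comm, norm_multiset_prod_map]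
    refine mul_le_mul_of_nonneg_right ?_ (norm_nonneg _)
    refine pow_card_le_multiset_prod (by linarith) fun a ha => ?_
    have := norm_sub_norm_le z a
    have := hsr a ha
    linarith
  have hQ0 := Complex.norm_le_of_forall_mem_frontier_norm_le Metric.isBounded_ball
    Q.differentiable.diffContOnCl hfr
    (subset_closure (Metric.mem_ball_self (by linarith)) : (0 : ℂ) ∈ _)
  have hp : ‖p.eval 0‖ ≤ r ^ s.card * (M * ‖p.eval 0‖ / (y - r) ^ s.card) := by
    conv_lhs => rw [heval 0, norm_mul, norm_multiset_prod_map]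
    refine mul_le_mul ?_ hQ0 (norm_nonneg _) (pow_nonneg hr.le _)
    refine multiset_prod_le_pow_card (fun a _ => norm_nonneg _) fun a ha => ?_
    simpa using hsr a ha
  have hyr : 0 < (y - r) ^ s.card := pow_pos (by linarith) _
  have h2 : (y - r) ^ s.card ≤ M * r ^ s.card := by
    rw [mul_div_assoc', le_div_iff₀ hyr] at hp
    nlinarith
  rw [show y / r - 1 = (y - r) / r by field_simp, div_pow, div_le_iff₀ (pow_pos hr _)]
  exact h2

/-- A bound on the logarithmic contribution at the real point `g` of a zero at `z`. -/
noncomputable def rootCost (z : ℂ) (g : ℝ) : ℝ := 1 + max 0 (-Real.log |g - z.re|)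

theorem measurable_rootCost (z : ℂ) : Measurable (rootCost z) := by
  unfold rootCost
  fun_prop

/-- If |z| ≥ 1, then |z| ≤ 2|g - z| and the difference is at most log 2. If |z| ≤ 1, then log|z| ≤ 0
and only the distance to the real part matters. The resulting bound has an integral over g that is
bounded uniformly in z. -/
theorem log_norm_sub_log_norm_sub_le {z : ℂ} (hz : z ≠ 0) {g : ℝ} (hg : |g| ≤ 1 / 2)
    (hgz : g ≠ z.re) : Real.log ‖z‖ - Real.log ‖(g : ℂ) - z‖ ≤ rootCost z g := by
  have hz0 : 0 < ‖z‖ := norm_pos_iff.mpr hz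
  have hsub : 0 < |g - z.re| := abs_pos.mpr (sub_ne_zero.mpr hgz)
  have hre : |g - z.re| ≤ ‖(g : ℂ) - z‖ := by
    simpa using Complex.abs_re_le_norm ((g : ℂ) - z)
  have hn : 0 < ‖(g : ℂ) - z‖ := hsub.trans_le hre
  unfold rootCost
  rcases le_total 1 ‖z‖ with h | h
  · have h1 : ‖z‖ ≤ 2 * ‖(g : ℂ) - z‖ := by
      have := norm_sub_norm_le z (g : ℂ)
      rw [norm_sub_rev, Complex.norm_real, Real.norm_eq_abs] at this
      linarith
    have h2 := Real.log_le_log hz0 h1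
    rw [Real.log_mul two_ne_zero hn.ne'] at h2
    have h3 : Real.log 2 ≤ 1 := by
      have := Real.log_le_sub_one_of_pos (zero_lt_two' ℝ)
      linarith
    have := le_max_left 0 (-Real.log |g - z.re|)
    linarith
  · have h1 := Real.log_nonpos hz0.le h
    have h2 := Real.log_le_log hsub hre
    have := le_max_right 0 (-Real.log |g - z.re|)
    linarith

theorem log_norm_sub_log_norm_sub_le_of_far {z : ℂ} {g r : ℝ} (hr : 1 ≤ r) (hz : r < ‖z‖)
    (hg : |g| ≤ 1 / 2) : Real.log ‖z‖ - Real.log ‖(g : ℂ) - z‖ ≤ 1 / r := by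
  have hz0 : 0 < ‖z‖ := by linarith
  have h1 : ‖z‖ * (1 - 1 / (2 * r)) ≤ ‖(g : ℂ) - z‖ := by
    have h := norm_sub_norm_le z (g : ℂ)
    rw [norm_sub_rev, Complex.norm_real, Real.norm_eq_abs] at h
    have h2 : 1 / 2 ≤ ‖z‖ * (1 / (2 * r)) := by
      rw [mul_one_div, le_div_iff₀ (by linarith)]
      linarith
    nlinarith
  have hε : 1 / (2 * r) ≤ 1 / 2 := by
    rw [div_le_div_iff₀ (by linarith) (by norm_num)]
    linarith
  have h2 := exp_neg_two_mul_le_one_sub (by positivity : 0 ≤ 1 / (2 * r)) hε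
  have h3 : ‖z‖ * Real.exp (-(1 / r)) ≤ ‖(g : ℂ) - z‖ := by
    refine le_trans (mul_le_mul_of_nonneg_left ?_ hz0.le) h1
    have h5 : 2 * (1 / (2 * r)) = 1 / r := by
      have : r ≠ 0 := by linarith
      field_simp
    rwa [h5] at h2
  have h4 := Real.log_le_log (by positivity) h3
  rw [Real.log_mul hz0.ne' (Real.exp_pos _).ne', Real.log_exp] at h4
  linarith

theorem log_multiset_prod_map {s : Multiset ℂ} {f : ℂ → ℝ} (h : ∀ a ∈ s, f a ≠ 0) :
    Real.log (s.map f).prod = (s.map fun a => Real.log (f a)).sum := by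
  induction s using Multiset.induction with
  | empty => simp
  | cons a s ih =>
    simp only [Multiset.map_cons, Multiset.prod_cons, Multiset.sum_cons]
    rw [Real.log_mul (h a (Multiset.mem_cons_self a s)), ih]
    · exact fun b hb => h b (Multiset.mem_cons_of_mem hb)
    · refine Multiset.prod_ne_zero ?_
      intro h0
      obtain ⟨b, hb, hb0⟩ := Multiset.mem_map.mp h0
      exact h b (Multiset.mem_cons_of_mem hb) hb0

/-- Both logarithms are sums over the roots, and the leading coefficient cancels. The roots beyond
radius `r` contribute at most `1 / r` each, and there are at most `d` of them. -/
theorem log_norm_eval_sub_le {p : ℂ[X]} (hp0 : p.eval 0 ≠ 0) {d : ℕ} (hd : p.natDegree ≤ d)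
    {r g : ℝ} (hr : 1 ≤ r) (hg : |g| ≤ 1 / 2) (hgz : ∀ z ∈ p.roots, g ≠ z.re) :
    Real.log ‖p.eval 0‖ - Real.log ‖p.eval (g : ℂ)‖ ≤
      ((p.roots.filter fun z => ‖z‖ ≤ r).map fun z => rootCost z g).sum + d / r := by
  have hpne : p ≠ 0 := by
    rintro rfl
    simp at hp0
  have hlog : ∀ w : ℂ, (∀ z ∈ p.roots, w ≠ z) → Real.log ‖p.eval w‖ =
      Real.log ‖p.leadingCoeff‖ + (p.roots.map fun z => Real.log ‖w - z‖).sum := by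
    intro w hw
    rw [(IsAlgClosed.splits p).eval_eq_prod_roots, norm_mul, norm_multiset_prod_map, Real.log_mul,
      log_multiset_prod_map]
    · exact fun z hz => norm_ne_zero_iff.mpr (sub_ne_zero.mpr (hw z hz))
    · exact norm_ne_zero_iff.mpr (leadingCoeff_ne_zero.mpr hpne)
    · refine Multiset.prod_ne_zero ?_
      intro h0
      obtain ⟨z, hz, hz0⟩ := Multiset.mem_map.mp h0
      exact hw z hz (sub_eq_zero.mp (norm_eq_zero.mp hz0))
  have hroot0 : ∀ z ∈ p.roots, z ≠ 0 := by
    rintro z hz rfl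
    exact hp0 ((mem_roots hpne).mp hz)
  rw [hlog 0 fun z hz => (hroot0 z hz).symm, hlog g fun z hz h => hgz z hz (by rw [← h]; simp)]
  rw [add_sub_add_left_eq_sub, ← Multiset.sum_map_sub]
  have hcard : (p.roots.card : ℝ) ≤ d := by
    exact_mod_cast (card_roots' p).trans hd
  have hgen : ∀ s : Multiset ℂ, (∀ z ∈ s, z ≠ 0 ∧ g ≠ z.re) →
      (s.map fun z => Real.log ‖0 - z‖ - Real.log ‖(g : ℂ) - z‖).sum ≤
        ((s.filter fun z => ‖z‖ ≤ r).map fun z => rootCost z g).sum + s.card * (1 / r) := by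
    intro s
    induction s using Multiset.induction with
    | empty => simp
    | cons a s ih =>
      intro hs
      have ih' := ih fun z hz => hs z (Multiset.mem_cons_of_mem hz)
      have ha := hs a (Multiset.mem_cons_self a s)
      have hr0 : 0 ≤ 1 / r := by positivity
      simp only [Multiset.map_cons, Multiset.sum_cons, Multiset.card_cons]
      by_cases har : ‖a‖ ≤ r
      · rw [Multiset.filter_cons_of_pos s (p := fun z => ‖z‖ ≤ r) har]
        simp only [Multiset.map_cons, Multiset.sum_cons]
        have := log_norm_sub_log_norm_sub_le ha.1 hg ha.2
        rw [zero_sub, norm_neg]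
        push_cast
        linarith
      · rw [Multiset.filter_cons_of_neg s (p := fun z => ‖z‖ ≤ r) har]
        have := log_norm_sub_log_norm_sub_le_of_far hr (not_le.mp har) hg
        rw [zero_sub, norm_neg]
        push_cast
        linarith
  refine (hgen p.roots fun z hz => ⟨hroot0 z hz, hgz z hz⟩).trans ?_
  have : (p.roots.card : ℝ) * (1 / r) ≤ d / r := by
    rw [mul_one_div]
    gcongr
  linarith

/-- After translation the integrand is the positive part of -log|g|, which lives on [-1, 1] and has
integral 2 there. -/
theorem lintegral_neg_log_abs_sub_le (c : ℝ) (s : Set ℝ) :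
    ∫⁻ g in s, ENNReal.ofReal (-Real.log |g - c|) ≤ 2 := by
  have h1 : ∫⁻ g in s, ENNReal.ofReal (-Real.log |g - c|) ≤
      ∫⁻ g, ENNReal.ofReal (-Real.log |g - c|) := setLIntegral_le_lintegral _ _
  refine h1.trans ?_
  rw [lintegral_sub_right_eq_self (fun g : ℝ => ENNReal.ofReal (-Real.log |g|)) c]
  have h2 : ∫⁻ g : ℝ, ENNReal.ofReal (-Real.log |g|) =
      ∫⁻ g in Set.Ioc (-1 : ℝ) 1, ENNReal.ofReal (-Real.log |g|) := by
    rw [← lintegral_indicator measurableSet_Ioc]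
    refine lintegral_congr fun g => ?_
    by_cases hg : g ∈ Set.Ioc (-1 : ℝ) 1
    · rw [Set.indicator_of_mem hg]
    · rw [Set.indicator_of_notMem hg, ENNReal.ofReal_eq_zero, neg_nonpos]
      refine Real.log_nonneg ?_
      rw [Set.mem_Ioc, not_and_or, not_lt, not_le] at hg
      rcases hg with hg | hg
      · rw [abs_of_neg (by linarith)]; linarith
      · rw [abs_of_pos (by linarith)]; exact hg.le
  rw [h2]
  have hint : IntervalIntegrable (fun g : ℝ => -Real.log |g|) volume (-1) 1 := by
    simp only [Real.log_abs]
    exact intervalIntegral.intervalIntegrable_log'.neg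
  rw [← ofReal_integral_eq_lintegral_ofReal]
  · rw [← intervalIntegral.integral_of_le (by norm_num)]
    simp only [Real.log_abs]
    rw [intervalIntegral.integral_neg, integral_log]
    norm_num
  · exact (intervalIntegrable_iff_integrableOn_Ioc_of_le (by norm_num)).mp hint
  · refine (ae_restrict_iff' measurableSet_Ioc).mpr (ae_of_all _ fun g hg => ?_)
    rw [Pi.zero_apply, neg_nonneg]
    exact Real.log_nonpos (abs_nonneg _) (abs_le.mpr ⟨hg.1.le, hg.2⟩)

theorem lintegral_rootCost_le (z : ℂ) :
    ∫⁻ g in Set.Icc (-1 / 2 : ℝ) (1 / 2), ENNReal.ofReal (rootCost z g) ≤ 3 := by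
  have h1 : ∀ g : ℝ, ENNReal.ofReal (rootCost z g) ≤ 1 + ENNReal.ofReal (-Real.log |g - z.re|) := by
    intro g
    unfold rootCost
    refine ENNReal.ofReal_add_le.trans ?_
    rw [ENNReal.ofReal_one, ENNReal.ofReal_max, ENNReal.ofReal_zero, max_eq_right zero_le]
  refine (lintegral_mono h1).trans ?_
  rw [lintegral_add_left measurable_const]
  have h2 := lintegral_neg_log_abs_sub_le z.re (Set.Icc (-1 / 2 : ℝ) (1 / 2))
  have h3 : ∫⁻ _ in Set.Icc (-1 / 2 : ℝ) (1 / 2), (1 : ENNReal) = 1 := by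
    rw [lintegral_one, Measure.restrict_apply_univ, Real.volume_Icc]
    norm_num
  rw [h3]
  calc (1 : ENNReal) + _ ≤ 1 + 2 := by gcongr
    _ = 3 := by norm_num

theorem lintegral_add_sum_rootCost_le (s : Multiset ℂ) (c : ℝ) :
    ∫⁻ g in Set.Icc (-1 / 2 : ℝ) (1 / 2),
      ENNReal.ofReal (c + (s.map fun z => rootCost z g).sum) ≤
        ENNReal.ofReal c + 3 * s.card := by
  induction s using Multiset.induction with
  | empty => simp [Real.volume_Icc]; norm_num
  | cons a s ih =>
    simp only [Multiset.map_cons, Multiset.sum_cons, Multiset.card_cons]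
    have h1 : ∀ g : ℝ, ENNReal.ofReal (c + (rootCost a g + (s.map fun z => rootCost z g).sum)) ≤
        ENNReal.ofReal (rootCost a g) +
          ENNReal.ofReal (c + (s.map fun z => rootCost z g).sum) := by
      intro g
      rw [add_left_comm]
      exact ENNReal.ofReal_add_le
    refine (lintegral_mono h1).trans ?_
    rw [lintegral_add_left (measurable_rootCost a).ennreal_ofReal]
    calc _ ≤ 3 + (ENNReal.ofReal c + 3 * (s.card : ENNReal)) :=
          add_le_add (lintegral_rootCost_le a) ih
      _ = _ := by push_cast; ring

/-- If a polynomial does not grow on a long real interval, then on average over `[-1/2, 1/2]` it is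
not much smaller than at the origin. -/
theorem lintegral_log_norm_eval_le {p : ℂ[X]} (hp0 : p.eval 0 ≠ 0) {d : ℕ} (hd : p.natDegree ≤ d)
    {R r y L c : ℝ} (hr : 1 ≤ r) (hry : 2 * r < y) (hyR : 2 * y ≤ R) (hc : 0 ≤ c)
    (hM : ∀ x : ℝ, |x| ≤ R → ‖p.eval (x : ℂ)‖ ≤ Real.exp L * ‖p.eval 0‖) :
    ∫⁻ g in Set.Icc (-1 / 2 : ℝ) (1 / 2),
      ENNReal.ofReal (c + (Real.log ‖p.eval 0‖ - Real.log ‖p.eval (g : ℂ)‖)) ≤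
        ENNReal.ofReal (c + d / r + 3 * ((L + 2 * d * (y / R)) / Real.log (y / r - 1))) := by
  set s := p.roots.filter fun z => ‖z‖ ≤ r with hs
  have hR : 0 < R := by linarith
  have hy : 0 < y := by linarith
  -- Two passages between scales: from the interval of half-length `R` to the disk of radius `y`, at
  -- the price `2 * d * (y / R)` in the exponent, and from there to the number of zeros in the disk
  -- of radius `r`.
  have hcount : (s.card : ℝ) ≤ (L + 2 * d * (y / R)) / Real.log (y / r - 1) := by
    have h1 : ∀ z : ℂ, ‖z‖ ≤ y →
        ‖p.eval z‖ ≤ Real.exp (L + 2 * d * (y / R)) * ‖p.eval 0‖ := by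
      intro z hz
      have := norm_eval_le_of_bounded_on_interval hd hR hM (ε := y / R)
        (div_nonneg hy.le hR.le)
        (by rw [div_le_div_iff₀ hR (by norm_num)]; linarith) (z := z)
        (by rwa [div_mul_cancel₀ _ hR.ne'])
      rw [Real.exp_add]
      linarith
    have h2 := pow_card_roots_le hp0 (r := r) (y := y) (by linarith) (by linarith) h1
    have hone : 1 < y / r - 1 := by
      rw [lt_sub_iff_add_lt, lt_div_iff₀ (by linarith)]
      linarith
    rw [le_div_iff₀ (Real.log_pos hone), ← Real.log_pow, Real.log_le_iff_le_exp]
    · exact h2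
    · exact pow_pos (by linarith) _
  have hae : ∀ᵐ g : ℝ ∂(volume.restrict (Set.Icc (-1 / 2 : ℝ) (1 / 2))),
      ENNReal.ofReal (c + (Real.log ‖p.eval 0‖ - Real.log ‖p.eval (g : ℂ)‖)) ≤
        ENNReal.ofReal ((c + d / r) + (s.map fun z => rootCost z g).sum) := by
    rw [ae_restrict_iff' measurableSet_Icc]
    -- At the real parts of the roots the logarithms take the default value `Real.log 0 = 0` and the
    -- pointwise bound may fail; these points form a finite, hence null, set.
    have hfin : (↑(p.roots.toFinset.image Complex.re) : Set ℝ).Finite := Finset.finite_toSet _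
    filter_upwards [hfin.measure_zero volume |> compl_mem_ae_iff.mpr] with g hg hgI
    refine ENNReal.ofReal_le_ofReal ?_
    have := log_norm_eval_sub_le hp0 hd hr (g := g)
      (abs_le.mpr ⟨by linarith [hgI.1], hgI.2⟩) (fun z hz h => hg (by
        simp only [Finset.coe_image, Set.mem_image, Finset.mem_coe, Multiset.mem_toFinset]
        exact ⟨z, hz, h.symm⟩))
    linarith
  refine (lintegral_mono_ae hae).trans ((lintegral_add_sum_rootCost_le s _).trans ?_)
  have hcd : 0 ≤ c + d / r := by positivity
  have hX : 0 ≤ (L + 2 * d * (y / R)) / Real.log (y / r - 1) := (Nat.cast_nonneg _).trans hcount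
  rw [ENNReal.ofReal_add hcd (by positivity), ENNReal.ofReal_mul (by norm_num)]
  gcongr
  · simp
  · rw [← ENNReal.ofReal_natCast]
    exact ENNReal.ofReal_le_ofReal hcount

end PolynomialGrowth

/-! ### Perturbation of the eigenvalues of Hermitian matrices -/

section Weyl

variable {E : Type*} [NormedAddCommGroup E] [InnerProductSpace ℂ E]

theorem inner_eq_zero_of_mem_span {ι : Type*} [Fintype ι] (b : OrthonormalBasis ι ℂ E)
    {S : Set ι} {v : E} (hv : v ∈ Submodule.span ℂ (Set.range fun i : S => b i)) {j : ι}
    (hj : j ∉ S) : inner ℂ (b j) v = 0 := by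
  induction hv using Submodule.span_induction with
  | mem x hx =>
    obtain ⟨i, rfl⟩ := hx
    exact b.orthonormal.2 fun h => hj (h ▸ i.2)
  | zero => simp
  | add x y _ _ hx hy => rw [inner_add_right, hx, hy, add_zero]
  | smul a x _ hx => rw [inner_smul_right, hx, mul_zero]

variable [FiniteDimensional ℂ E] {T T' : E →ₗ[ℂ] E} {n : ℕ}

theorem re_inner_eq_sum_eigenvalues (hT : T.IsSymmetric) (hn : Module.finrank ℂ E = n) (v : E) :
    (inner ℂ v (T v)).re =
      ∑ j, hT.eigenvalues hn j * ‖inner ℂ (hT.eigenvectorBasis hn j) v‖ ^ 2 := by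
  rw [← (hT.eigenvectorBasis hn).sum_inner_mul_inner v (T v), Complex.re_sum]
  refine Finset.sum_congr rfl fun j _ => ?_
  rw [← hT (hT.eigenvectorBasis hn j) v, hT.apply_eigenvectorBasis, inner_smul_left,
    RCLike.conj_ofReal, ← inner_conj_symm v, mul_left_comm, Complex.conj_mul',
    ← Complex.ofReal_pow]
  exact Complex.re_ofReal_mul _ _

/-- Weyl's inequality by dimension counting. The eigenvalues are in decreasing order, so the first
`i + 1` eigenvectors of `T` and the last `n - i` of `T'` span subspaces whose dimensions sum to `n +
1`. A common nonzero vector compares the two quadratic forms. -/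
theorem eigenvalues_le_of_re_inner_le (hT : T.IsSymmetric) (hT' : T'.IsSymmetric)
    (hn : Module.finrank ℂ E = n) {c : ℝ}
    (h : ∀ v, (inner ℂ v (T v)).re ≤ (inner ℂ v (T' v)).re + c * ‖v‖ ^ 2) (i : Fin n) :
    hT.eigenvalues hn i ≤ hT'.eigenvalues hn i + c := by
  set b := hT.eigenvectorBasis hn
  set b' := hT'.eigenvectorBasis hn
  set V := Submodule.span ℂ (Set.range fun j : Set.Iic i => b j)
  set V' := Submodule.span ℂ (Set.range fun j : Set.Ici i => b' j)
  have hV : Module.finrank ℂ V = i + 1 := by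
    have := finrank_span_eq_card (b.orthonormal.linearIndependent.comp
      (Subtype.val : Set.Iic i → Fin n) Subtype.val_injective)
    rwa [← Set.toFinset_card, Set.toFinset_Iic, Fin.card_Iic] at this
  have hV' : Module.finrank ℂ V' = n - i := by
    have := finrank_span_eq_card (b'.orthonormal.linearIndependent.comp
      (Subtype.val : Set.Ici i → Fin n) Subtype.val_injective)
    rwa [← Set.toFinset_card, Set.toFinset_Ici, Fin.card_Ici] at this
  have hnd : ¬ Disjoint V V' := by
    intro hd
    have := Submodule.finrank_add_finrank_le_of_disjoint hd
    rw [hV, hV', hn] at this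
    have := i.isLt
    omega
  obtain ⟨v, hv, hv', hv0⟩ : ∃ v, v ∈ V ∧ v ∈ V' ∧ v ≠ 0 := by
    rw [Submodule.disjoint_def] at hnd
    push Not at hnd
    exact hnd
  have h1 : hT.eigenvalues hn i * ‖v‖ ^ 2 ≤ (inner ℂ v (T v)).re := by
    rw [re_inner_eq_sum_eigenvalues hT hn, ← b.sum_sq_norm_inner_right v, Finset.mul_sum]
    refine Finset.sum_le_sum fun j _ => ?_
    by_cases hj : j ∈ Set.Iic i
    · exact mul_le_mul_of_nonneg_right (hT.eigenvalues_antitone hn hj) (sq_nonneg _)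
    · rw [inner_eq_zero_of_mem_span b hv hj]
      simp
  have h2 : (inner ℂ v (T' v)).re ≤ hT'.eigenvalues hn i * ‖v‖ ^ 2 := by
    rw [re_inner_eq_sum_eigenvalues hT' hn, ← b'.sum_sq_norm_inner_right v, Finset.mul_sum]
    refine Finset.sum_le_sum fun j _ => ?_
    by_cases hj : j ∈ Set.Ici i
    · exact mul_le_mul_of_nonneg_right (hT'.eigenvalues_antitone hn hj) (sq_nonneg _)
    · rw [inner_eq_zero_of_mem_span b' hv' hj]
      simp
  have hpos : 0 < ‖v‖ ^ 2 := by positivity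
  have h3 := h v
  by_contra! hlt
  nlinarith

end Weyl

open Matrix in
-- The sum of the absolute values of all entries is a crude substitute for the operator norm. For
-- the coupling it costs a factor of at most 4 to the number of spins, which the powers of `q`
-- absorb later.
theorem norm_inner_mulVec_le {κ : Type*} [Fintype κ] [DecidableEq κ] (M : Matrix κ κ ℂ)
    (v : EuclideanSpace ℂ κ) :
    ‖inner ℂ v (Matrix.toEuclideanLin M v)‖ ≤ (∑ σ, ∑ τ, ‖M σ τ‖) * ‖v‖ ^ 2 := by
  rw [PiLp.inner_apply]
  refine (norm_sum_le _ _).trans ?_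
  rw [Finset.sum_mul]
  refine Finset.sum_le_sum fun σ _ => ?_
  refine (norm_inner_le_norm _ _).trans ?_
  rw [Finset.sum_mul]
  have h1 : ‖(Matrix.toEuclideanLin M v) σ‖ ≤ ∑ τ, ‖M σ τ‖ * ‖v‖ := by
    rw [Matrix.toLpLin_apply]
    simp only [Matrix.mulVec, dotProduct]
    refine (norm_sum_le _ _).trans (Finset.sum_le_sum fun τ _ => ?_)
    rw [norm_mul]
    exact mul_le_mul_of_nonneg_left (PiLp.norm_apply_le v τ) (norm_nonneg _)
  calc ‖v σ‖ * ‖(Matrix.toEuclideanLin M v) σ‖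
      ≤ ‖v‖ * ∑ τ, ‖M σ τ‖ * ‖v‖ :=
        mul_le_mul (PiLp.norm_apply_le v σ) h1 (norm_nonneg _) (norm_nonneg _)
    _ = ∑ τ, ‖M σ τ‖ * ‖v‖ ^ 2 := by
        rw [Finset.mul_sum]
        exact Finset.sum_congr rfl fun τ _ => by ring

theorem levels_le_add_sum_norm {n : ℕ} {A B : Op n} (hA : A.IsHermitian) (hB : B.IsHermitian)
    (i : Fin (2 ^ n)) : levels hA i ≤ levels hB i + ∑ σ, ∑ τ, ‖A σ τ - B σ τ‖ := by
  refine eigenvalues_le_of_re_inner_le _ _ _ (fun v => ?_) _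
  have h := (Complex.re_le_norm _).trans (norm_inner_mulVec_le (A - B) v)
  rw [map_sub, LinearMap.sub_apply, inner_sub_right, Complex.sub_re] at h
  simp only [Matrix.sub_apply] at h
  linarith

theorem abs_levels_sub_le {n : ℕ} {A B : Op n} (hA : A.IsHermitian) (hB : B.IsHermitian)
    (i : Fin (2 ^ n)) : |levels hA i - levels hB i| ≤ ∑ σ, ∑ τ, ‖A σ τ - B σ τ‖ := by
  have h1 := levels_le_add_sum_norm hA hB i
  have h2 := levels_le_add_sum_norm hB hA i
  simp only [norm_sub_rev (B _ _)] at h2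
  rw [abs_le]
  constructor <;> linarith

/-! ### Power sums of the eigenvalues and the discriminant -/

open Unitary in
theorem sum_levels_pow {n : ℕ} {A : Op n} (hA : A.IsHermitian) (k : ℕ) :
    ∑ i, ((levels hA i : ℝ) : ℂ) ^ k = (A ^ k).trace := by
  have h1 : (A ^ k).trace = ∑ i, ((hA.eigenvalues i : ℝ) : ℂ) ^ k := by
    conv_lhs => rw [hA.spectral_theorem, ← map_pow, conjStarAlgAut_apply, Matrix.trace_mul_comm,
      ← mul_assoc, Unitary.coe_star_mul_self, one_mul, Matrix.diagonal_pow]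
    simp [Matrix.trace]
  rw [h1]
  unfold levels Matrix.IsHermitian.eigenvalues
  let e : Fin (2 ^ n) ≃ Fin (Fintype.card (Config n)) := Fin.revPerm.trans (finCongr (card_config n))
  have h2 : ∑ i : Fin (2 ^ n), ((hA.eigenvalues₀ (Fin.cast (card_config n) i.rev) : ℝ) : ℂ) ^ k =
      ∑ j, ((hA.eigenvalues₀ j : ℝ) : ℂ) ^ k :=
    e.sum_comp fun j => ((hA.eigenvalues₀ j : ℝ) : ℂ) ^ k
  rw [h2]
  exact ((Fintype.equivOfCardEq (Fintype.card_fin _)).symm.sum_comp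
    fun j => ((hA.eigenvalues₀ j : ℝ) : ℂ) ^ k).symm

/-- The Hankel matrix of power sums is `Vᵀ * V` for the Vandermonde matrix `V`, so its determinant
is the discriminant. Its entries are traces of powers of the operator, so no eigenvalue has to be
followed analytically in a parameter. -/
theorem norm_det_power_sums {N : ℕ} (E : Fin N → ℝ) :
    ‖(Matrix.of fun a b : Fin N => ∑ i, (E i : ℂ) ^ ((a : ℕ) + b)).det‖ =
      ∏ i, ∏ j ∈ ({i}ᶜ : Finset (Fin N)), |E i - E j| := by
  set V : Matrix (Fin N) (Fin N) ℂ := Matrix.vandermonde fun i => (E i : ℂ)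
  have h1 : (Matrix.of fun a b : Fin N => ∑ i, (E i : ℂ) ^ ((a : ℕ) + b)) = V.transpose * V := by
    ext a b
    simp [V, Matrix.mul_apply, Matrix.vandermonde_apply, pow_add]
  rw [h1, Matrix.det_mul, Matrix.det_transpose, norm_mul, Matrix.det_vandermonde,
    ← Finset.prod_prod_Ioi_mul_eq_prod_prod_off_diag]
  simp only [norm_prod, ← Complex.ofReal_sub, Complex.norm_real, Real.norm_eq_abs]
  rw [← Finset.prod_mul_distrib]
  refine Finset.prod_congr rfl fun i _ => ?_
  rw [← Finset.prod_mul_distrib]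
  refine Finset.prod_congr rfl fun j _ => ?_
  rw [abs_sub_comm (E i)]

open Polynomial in
theorem exists_trace_pow_polynomial {κ : Type*} [Fintype κ] [DecidableEq κ] (A B : Matrix κ κ ℂ)
    (k : ℕ) : ∃ p : ℂ[X], p.natDegree ≤ k ∧ ∀ z : ℂ, p.eval z = ((A + z • B) ^ k).trace := by
  set M : Matrix κ κ ℂ[X] := A.map C + (X : ℂ[X]) • B.map C with hM
  have hMdeg : ∀ k : ℕ, ∀ σ τ, ((M ^ k) σ τ).natDegree ≤ k := by
    intro k
    induction k with
    | zero =>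
      intro σ τ
      rw [pow_zero, Matrix.one_apply]
      split_ifs <;> simp
    | succ k ih =>
      intro σ τ
      rw [pow_succ, Matrix.mul_apply]
      refine natDegree_sum_le_of_forall_le _ _ fun ρ _ => ?_
      refine natDegree_mul_le.trans (add_le_add (ih σ ρ) ?_)
      rw [hM]
      simp only [Matrix.add_apply, Matrix.map_apply, Matrix.smul_apply, smul_eq_mul]
      refine (natDegree_add_le _ _).trans (max_le (by simp) ?_)
      refine natDegree_mul_le.trans ?_
      simp
  refine ⟨(M ^ k).trace, natDegree_sum_le_of_forall_le _ _ fun σ _ => hMdeg k σ σ, fun z => ?_⟩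
  have h1 : M.map (evalRingHom z) = A + z • B := by
    ext σ τ
    simp only [hM, Matrix.map_apply, Matrix.add_apply, Matrix.smul_apply, smul_eq_mul,
      coe_evalRingHom, eval_add, eval_mul, eval_X, eval_C]
  have h2 : (M ^ k).map (evalRingHom z) = (A + z • B) ^ k := by
    rw [← h1]
    exact map_pow (evalRingHom z).mapMatrix M k
  rw [← h2, ← coe_evalRingHom, Matrix.trace, map_sum]
  rfl

open Polynomial in
/-- The discriminant of the spectrum of `A + z • B` is a polynomial in `z`. -/
theorem exists_discriminant_polynomial {n : ℕ} (A B : Op n)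
    (h : ∀ y : ℝ, (A + (y : ℂ) • B).IsHermitian) :
    ∃ p : ℂ[X], p.natDegree ≤ 2 * 4 ^ n ∧ ∀ y : ℝ,
      ‖p.eval (y : ℂ)‖ = ∏ i, ∏ j ∈ ({i}ᶜ : Finset (Fin (2 ^ n))),
        |levels (h y) i - levels (h y) j| := by
  choose t htdeg ht using exists_trace_pow_polynomial A B
  set T : Matrix (Fin (2 ^ n)) (Fin (2 ^ n)) ℂ[X] := Matrix.of fun a b => t ((a : ℕ) + b) with hT
  refine ⟨T.det, ?_, fun y => ?_⟩
  · rw [Matrix.det_apply]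
    refine natDegree_sum_le_of_forall_le _ _ fun σ _ => ?_
    refine (natDegree_smul_le _ _).trans ((natDegree_prod_le _ _).trans ?_)
    -- The entry at `(a, b)` has degree at most `a + b ≤ 2 * 2 ^ n`, and each term of the
    -- determinant has `2 ^ n` factors.
    refine (Finset.sum_le_card_nsmul _ _ (2 * 2 ^ n) fun i _ => ?_).trans ?_
    · refine (htdeg _).trans ?_
      have := (σ i).isLt
      have := i.isLt
      omega
    · rw [Finset.card_univ, Fintype.card_fin, smul_eq_mul, show 4 = 2 * 2 by norm_num, mul_pow]
      exact le_of_eq (by ring)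
  · rw [← norm_det_power_sums, ← coe_evalRingHom, RingHom.map_det]
    congr 2
    ext a b
    rw [RingHom.mapMatrix_apply, Matrix.map_apply, hT, Matrix.of_apply, coe_evalRingHom, ht,
      ← sum_levels_pow (h y), Matrix.of_apply]

/-! ### Adding a spin -/

/-- Fibres over the same value have the same cardinality and are matched arbitrarily. This turns
equalities of root multisets into relabellings of levels, which sorting does not provide directly.
-/
theorem exists_equiv_of_map_univ_eq {α β γ : Type*} [Fintype α] [Fintype β] {f : α → γ} {g : β → γ}
    (h : Finset.univ.val.map f = Finset.univ.val.map g) : ∃ e : α ≃ β, ∀ a, g (e a) = f a := by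
  classical
  have hc : ∀ c, Nonempty ({ a // f a = c } ≃ { b // g b = c }) := by
    intro c
    refine ⟨Fintype.equivOfCardEq ?_⟩
    have h1 := congrArg (Multiset.count c) h
    rw [Multiset.count_map, Multiset.count_map] at h1
    rw [Fintype.card_subtype, Fintype.card_subtype]
    simpa [Finset.card_def, eq_comm] using h1
  exact ⟨Equiv.ofFiberEquiv fun c => Classical.choice (hc c), fun a => Equiv.ofFiberEquiv_map _ a⟩

theorem charpoly_roots_eq_levels {n : ℕ} {A : Op n} (hA : A.IsHermitian) :
    A.charpoly.roots = Finset.univ.val.map fun i => ((levels hA i : ℝ) : ℂ) := by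
  rw [hA.roots_charpoly_eq_eigenvalues₀]
  let e : Fin (2 ^ n) ≃ Fin (Fintype.card (Config n)) := Fin.revPerm.trans (finCongr (card_config n))
  have h1 : (fun i => ((levels hA i : ℝ) : ℂ)) =
      (RCLike.ofReal ∘ hA.eigenvalues₀ : _ → ℂ) ∘ e := rfl
  rw [h1, ← Multiset.map_map _ e, Multiset.map_univ_val_equiv e]

theorem charpoly_blockDiagonal {κ o : Type*} [Fintype κ] [DecidableEq κ] [Fintype o]
    [DecidableEq o] (M : o → Matrix κ κ ℂ) :
    (Matrix.blockDiagonal M).charpoly = ∏ k, (M k).charpoly := by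
  unfold Matrix.charpoly
  rw [← Matrix.det_blockDiagonal]
  congr 1
  ext1 ⟨i, k⟩ ⟨j, l⟩
  rw [Matrix.charmatrix_apply, Matrix.blockDiagonal_apply, Matrix.blockDiagonal_apply]
  by_cases hkl : k = l
  · subst hkl
    by_cases hij : i = j
    · subst hij
      simp
    · simp [hij]
  · simp [hkl]

/-- The eigenvalues `1` and `-1` of the Pauli matrix `Z`. -/
def zSign : Fin 2 → ℝ := ![1, -1]

/-- Reordering the basis by the last spin gives the blocks A + c and A - c, so the characteristic
polynomial is a product of two translates of that of `A`. Comparing roots gives the levels with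
multiplicity. -/
theorem exists_equiv_levels_of_blockDiagonal {n : ℕ} {A : Op n} (hA : A.IsHermitian)
    {B : Op (n + 1)} (hB : B.IsHermitian) (c : ℝ)
    (h : ∀ σ τ, B σ τ = if σ (Fin.last n) = τ (Fin.last n) then
      (A + Matrix.scalar (Config n) ((zSign (σ (Fin.last n)) * c : ℝ) : ℂ))
        (fun i => σ i.castSucc) (fun i => τ i.castSucc) else 0) :
    ∃ e : Fin (2 ^ n) × Fin 2 ≃ Fin (2 ^ (n + 1)),
      ∀ x, levels hB (e x) = levels hA x.1 + zSign x.2 * c := by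
  let f : Config (n + 1) ≃ Config n × Fin 2 :=
    (Fin.snocEquiv fun _ => Fin 2).symm.trans (Equiv.prodComm _ _)
  have h1 : Matrix.reindex f f B = Matrix.blockDiagonal fun s : Fin 2 =>
      A + Matrix.scalar (Config n) ((zSign s * c : ℝ) : ℂ) := by
    ext1 ⟨σ, s⟩ ⟨τ, t⟩
    rw [Matrix.reindex_apply, Matrix.submatrix_apply, h, Matrix.blockDiagonal_apply]
    simp [f, Fin.snocEquiv]
  have h2 : B.charpoly.roots = Finset.univ.val.map
      fun x : Fin (2 ^ n) × Fin 2 => ((levels hA x.1 + zSign x.2 * c : ℝ) : ℂ) := by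
    rw [← Matrix.charpoly_reindex f B, h1, charpoly_blockDiagonal]
    have h3 : ∀ s : Fin 2,
        (A + Matrix.scalar (Config n) ((zSign s * c : ℝ) : ℂ)).charpoly =
          ∏ i, (Polynomial.X - Polynomial.C ((levels hA i + zSign s * c : ℝ) : ℂ)) := by
      intro s
      have h4 := Matrix.charpoly_sub_scalar A (-((zSign s * c : ℝ) : ℂ))
      rw [map_neg, sub_neg_eq_add] at h4
      rw [h4]
      conv_lhs => rw [(IsAlgClosed.splits A.charpoly).eq_prod_roots,
        (Matrix.charpoly_monic A).leadingCoeff, charpoly_roots_eq_levels hA]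
      rw [Multiset.map_map, Polynomial.C_1, one_mul]
      change (∏ i, _ : Polynomial ℂ).comp _ = _
      rw [Polynomial.prod_comp]
      refine Finset.prod_congr rfl fun i _ => ?_
      simp
      ring
    simp only [h3]
    rw [← Finset.prod_product_right', Finset.univ_product_univ]
    exact Polynomial.roots_multiset_prod_X_sub_C
      (Finset.univ.val.map fun x : Fin (2 ^ n) × Fin 2 => ((levels hA x.1 + zSign x.2 * c : ℝ) : ℂ))
      |> fun h => by simpa [Multiset.map_map] using h
  rw [charpoly_roots_eq_levels hB] at h2
  obtain ⟨e, he⟩ := exists_equiv_of_map_univ_eq h2.symm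
  exact ⟨e, fun x => by exact_mod_cast he x⟩

/-! ### The Hamiltonian with one more spin -/

theorem tensorOp_succ_apply {n : ℕ} (A : Fin (n + 1) → Matrix (Fin 2) (Fin 2) ℂ)
    (σ τ : Config (n + 1)) :
    tensorOp A σ τ = tensorOp (fun j => A j.castSucc) (fun j => σ j.castSucc)
      (fun j => τ j.castSucc) * A (Fin.last n) (σ (Fin.last n)) (τ (Fin.last n)) := by
  simp only [tensorOp]
  rw [Fin.prod_univ_castSucc]

theorem tensorOp_one (n : ℕ) : tensorOp (fun _ : Fin n => (1 : Matrix (Fin 2) (Fin 2) ℂ)) = 1 := by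
  ext σ τ
  simp only [tensorOp, Matrix.one_apply, Finset.prod_ite_zero, Finset.prod_const_one,
    Finset.mem_univ, true_imp_iff, funext_iff]

theorem siteOp_castSucc_apply {n : ℕ} (i : Fin n) (A : Matrix (Fin 2) (Fin 2) ℂ)
    (σ τ : Config (n + 1)) :
    siteOp i.castSucc A σ τ = if σ (Fin.last n) = τ (Fin.last n) then
      siteOp i A (fun j => σ j.castSucc) (fun j => τ j.castSucc) else 0 := by
  unfold siteOp
  rw [tensorOp_succ_apply, if_neg (Fin.castSucc_lt_last i).ne', Matrix.one_apply, mul_ite, mul_one,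
    mul_zero]
  simp only [Fin.castSucc_inj]

theorem siteOp_last_apply {n : ℕ} (A : Matrix (Fin 2) (Fin 2) ℂ) (σ τ : Config (n + 1)) :
    siteOp (Fin.last n) A σ τ = (1 : Op n) (fun j => σ j.castSucc) (fun j => τ j.castSucc) *
      A (σ (Fin.last n)) (τ (Fin.last n)) := by
  unfold siteOp
  rw [tensorOp_succ_apply, if_pos rfl]
  simp only [(Fin.castSucc_lt_last _).ne, if_false]
  rw [tensorOp_one]

theorem siteOp_mul_siteOp_castSucc_apply {n : ℕ} (i k : Fin n) (A B : Matrix (Fin 2) (Fin 2) ℂ)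
    (σ τ : Config (n + 1)) :
    (siteOp i.castSucc A * siteOp k.castSucc B) σ τ = if σ (Fin.last n) = τ (Fin.last n) then
      (siteOp i A * siteOp k B) (fun j => σ j.castSucc) (fun j => τ j.castSucc) else 0 := by
  unfold siteOp
  rw [tensorOp_mul, tensorOp_mul, tensorOp_succ_apply, if_neg (Fin.castSucc_lt_last i).ne',
    if_neg (Fin.castSucc_lt_last k).ne', mul_one, Matrix.one_apply, mul_ite, mul_one, mul_zero]
  simp only [Fin.castSucc_inj]

theorem bathOp_succ_apply {nB : ℕ} (m : ℕ) (HB : Op nB) (σ τ : Config (nB + m + 1)) :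
    bathOp (m + 1) HB σ τ = if σ (Fin.last (nB + m)) = τ (Fin.last (nB + m)) then
      bathOp m HB (fun j => σ j.castSucc) (fun j => τ j.castSucc) else 0 := by
  unfold bathOp
  have h1 : (∀ j : Fin (m + 1), σ (Fin.natAdd nB j) = τ (Fin.natAdd nB j)) ↔
      (∀ j : Fin m, σ (Fin.natAdd nB j).castSucc = τ (Fin.natAdd nB j).castSucc) ∧
        σ (Fin.last (nB + m)) = τ (Fin.last (nB + m)) := by
    rw [Fin.forall_fin_succ']
    rfl
  by_cases hl : σ (Fin.last (nB + m)) = τ (Fin.last (nB + m))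
  · rw [if_pos hl]
    refine if_congr (h1.trans (and_iff_left hl)) rfl rfl
  · rw [if_neg hl, if_neg fun h => hl (h1.mp h).2]

/-- The operator `X_1 X_i` for the last site `i = nB + m + 1`. -/
def couplingOp (nB m : ℕ) : Op (nB + (m + 1)) :=
  siteOp ⟨0, Nat.succ_pos _⟩ pauliX * siteOp (Fin.last (nB + m)) pauliX

theorem pauliZ_apply (s t : Fin 2) : pauliZ s t = if s = t then ((zSign s : ℝ) : ℂ) else 0 := by
  fin_cases s <;> fin_cases t <;> simp [pauliZ, zSign]

theorem hamiltonian_succ_apply {nB : ℕ} (HB : Op nB) (α : ℝ) (h g : ℕ → ℝ) (m : ℕ)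
    (σ τ : Config (nB + m + 1)) :
    hamiltonian HB α h g (m + 1) σ τ =
      (if σ (Fin.last (nB + m)) = τ (Fin.last (nB + m)) then
        (hamiltonian HB α h g m +
          Matrix.scalar (Config (nB + m)) ((zSign (σ (Fin.last (nB + m))) * h m : ℝ) : ℂ))
          (fun j => σ j.castSucc) (fun j => τ j.castSucc) else 0) +
      ((g m : ℝ) : ℂ) * (((α ^ (nB + m + 1) : ℝ) : ℂ) • couplingOp nB m) σ τ := by
  have hsum : ∀ j : Fin m,
      ((((h j : ℝ) : ℂ) • siteOp (Fin.natAdd nB j.castSucc : Fin (nB + m + 1)) pauliZ +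
      ((α ^ (nB + (j : ℕ) + 1) * g j : ℝ) : ℂ) •
        (siteOp (⟨0, Nat.succ_pos _⟩ : Fin (nB + m + 1)) pauliX *
          siteOp (Fin.natAdd nB j.castSucc : Fin (nB + m + 1)) pauliX)) σ τ) =
      if σ (Fin.last (nB + m)) = τ (Fin.last (nB + m)) then
        (((h j : ℝ) : ℂ) • siteOp (Fin.natAdd nB j) pauliZ +
      ((α ^ (nB + (j : ℕ) + 1) * g j : ℝ) : ℂ) •
        (siteOp ⟨0, Nat.lt_of_le_of_lt (Nat.zero_le _) (Fin.natAdd nB j).isLt⟩ pauliX *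
          siteOp (Fin.natAdd nB j) pauliX)) (fun j => σ j.castSucc) (fun j => τ j.castSucc)
      else 0 := by
    intro j
    have e1 : (Fin.natAdd nB j.castSucc : Fin (nB + m + 1)) = (Fin.natAdd nB j).castSucc := rfl
    have e2 : (⟨0, Nat.succ_pos _⟩ : Fin (nB + m + 1)) =
      (⟨0, Nat.lt_of_le_of_lt (Nat.zero_le _) (Fin.natAdd nB j).isLt⟩ : Fin (nB + m)).castSucc :=
      rfl
    rw [e1, e2, Matrix.add_apply, Matrix.smul_apply, Matrix.smul_apply, siteOp_castSucc_apply,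
      siteOp_mul_siteOp_castSucc_apply, Matrix.add_apply, Matrix.smul_apply, Matrix.smul_apply]
    split_ifs <;> simp
  have hlast : (((h m : ℝ) : ℂ) • siteOp (Fin.last (nB + m)) pauliZ) σ τ =
      if σ (Fin.last (nB + m)) = τ (Fin.last (nB + m)) then
        (Matrix.scalar (Config (nB + m)) ((zSign (σ (Fin.last (nB + m))) * h m : ℝ) : ℂ))
          (fun j => σ j.castSucc) (fun j => τ j.castSucc) else 0 := by
    rw [Matrix.smul_apply, siteOp_last_apply, pauliZ_apply]
    split_ifs with hst
    · rw [Matrix.scalar_apply, Matrix.diagonal_apply, Matrix.one_apply]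
      split_ifs <;> simp [mul_comm]
    · simp
  have hH : hamiltonian HB α h g (m + 1) σ τ = bathOp (m + 1) HB σ τ +
      ((∑ j : Fin m,
        (((h j : ℝ) : ℂ) • siteOp (Fin.natAdd nB j.castSucc : Fin (nB + m + 1)) pauliZ +
        ((α ^ (nB + (j : ℕ) + 1) * g j : ℝ) : ℂ) •
          (siteOp (⟨0, Nat.succ_pos _⟩ : Fin (nB + m + 1)) pauliX *
            siteOp (Fin.natAdd nB j.castSucc : Fin (nB + m + 1)) pauliX)) σ τ) +
        ((((h m : ℝ) : ℂ) • siteOp (Fin.last (nB + m)) pauliZ) σ τ +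
        ((α ^ (nB + m + 1) * g m : ℝ) : ℂ) * couplingOp nB m σ τ)) := by
    unfold hamiltonian
    rw [Matrix.add_apply, Matrix.sum_apply, Fin.sum_univ_castSucc]
    rfl
  rw [hH, Finset.sum_congr rfl fun j _ => hsum j, hlast, bathOp_succ_apply]
  unfold hamiltonian
  rw [Matrix.add_apply, Matrix.add_apply, Matrix.sum_apply, Matrix.smul_apply]
  split_ifs <;> push_cast <;> simp <;> ring

theorem norm_tensorOp_apply_le {n : ℕ} {A : Fin n → Matrix (Fin 2) (Fin 2) ℂ}
    (hA : ∀ j s t, ‖A j s t‖ ≤ 1) (σ τ : Config n) : ‖tensorOp A σ τ‖ ≤ 1 := by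
  unfold tensorOp
  rw [norm_prod]
  exact Finset.prod_le_one (fun _ _ => norm_nonneg _) fun j _ => hA j _ _

theorem norm_couplingOp_apply_le (nB m : ℕ) (σ τ : Config (nB + (m + 1))) :
    ‖couplingOp nB m σ τ‖ ≤ 1 := by
  unfold couplingOp siteOp
  rw [tensorOp_mul]
  refine norm_tensorOp_apply_le (fun j s t => ?_) σ τ
  split_ifs <;> fin_cases s <;> fin_cases t <;> simp [pauliX, Matrix.mul_apply, Matrix.one_apply]

theorem sum_norm_couplingOp_le (nB m : ℕ) :
    ∑ σ, ∑ τ, ‖couplingOp nB m σ τ‖ ≤ 4 ^ (nB + (m + 1)) := by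
  refine (Finset.sum_le_sum fun σ _ => Finset.sum_le_sum fun τ _ =>
    norm_couplingOp_apply_le nB m σ τ).trans (le_of_eq ?_)
  simp only [Finset.sum_const, Finset.card_univ, nsmul_eq_mul, mul_one, ← card_config]
  push_cast
  rw [← mul_pow]
  norm_num

/-! ### The energy levels as functions of the parameters -/

section Energies

variable {nB : ℕ} {HB : Op nB} (hHB : HB.IsHermitian) (α : ℝ)

/-- The energy levels with `m` sites outside the bath, as a function of the parameters
`h = w ∘ Sum.inl` and `g = w ∘ Sum.inr`. -/
noncomputable def energies (m : ℕ) (w : ℕ ⊕ ℕ → ℝ) : Fin (2 ^ (nB + m)) → ℝ :=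
  levels (hamiltonian_isHermitian hHB α (fun i => w (Sum.inl i)) (fun i => w (Sum.inr i)) m)

theorem hamiltonian_congr {h h' g g' : ℕ → ℝ} {m : ℕ} (hh : ∀ i < m, h i = h' i)
    (hg : ∀ i < m, g i = g' i) : hamiltonian HB α h g m = hamiltonian HB α h' g' m := by
  unfold hamiltonian
  congr 1
  refine Finset.sum_congr rfl fun j _ => ?_
  rw [hh j j.isLt, hg j j.isLt]

theorem levels_congr {n : ℕ} {A B : Op n} (hA : A.IsHermitian) (hB : B.IsHermitian) (h : A = B) :
    levels hA = levels hB := by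
  subst h
  rfl

theorem energies_congr {m : ℕ} {w w' : ℕ ⊕ ℕ → ℝ} (hl : ∀ i < m, w (Sum.inl i) = w' (Sum.inl i))
    (hr : ∀ i < m, w (Sum.inr i) = w' (Sum.inr i)) :
    energies hHB α m w = energies hHB α m w' :=
  levels_congr _ _ (hamiltonian_congr α hl hr)

theorem continuous_energies (m : ℕ) (i : Fin (2 ^ (nB + m))) :
    Continuous fun w => energies hHB α m w i := by
  have hentry : ∀ σ τ : Config (nB + m), Continuous fun w : ℕ ⊕ ℕ → ℝ =>
      hamiltonian HB α (fun i => w (Sum.inl i)) (fun i => w (Sum.inr i)) m σ τ := by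
    intro σ τ
    unfold hamiltonian
    simp only [Matrix.add_apply, Matrix.sum_apply, Matrix.smul_apply]
    fun_prop
  rw [continuous_iff_continuousAt]
  intro w₀
  have hlim : Tendsto (fun w : ℕ ⊕ ℕ → ℝ => ∑ σ, ∑ τ,
      ‖hamiltonian HB α (fun i => w (Sum.inl i)) (fun i => w (Sum.inr i)) m σ τ -
        hamiltonian HB α (fun i => w₀ (Sum.inl i)) (fun i => w₀ (Sum.inr i)) m σ τ‖)
      (𝓝 w₀) (𝓝 0) := by
    have hc : Continuous (fun w : ℕ ⊕ ℕ → ℝ => ∑ σ, ∑ τ,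
      ‖hamiltonian HB α (fun i => w (Sum.inl i)) (fun i => w (Sum.inr i)) m σ τ -
        hamiltonian HB α (fun i => w₀ (Sum.inl i)) (fun i => w₀ (Sum.inr i)) m σ τ‖) :=
      continuous_finsetSum _ fun σ _ => continuous_finsetSum _ fun τ _ =>
        ((hentry σ τ).sub continuous_const).norm
    have := hc.tendsto w₀
    simpa using this
  rw [ContinuousAt, tendsto_iff_norm_sub_tendsto_zero]
  exact squeeze_zero (fun _ => norm_nonneg _) (fun w => abs_levels_sub_le _ _ i) hlim

theorem measurable_energies (m : ℕ) (i : Fin (2 ^ (nB + m))) :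
    Measurable fun w => energies hHB α m w i := (continuous_energies hHB α m i).measurable

/-- Without coupling to the new spin, every level splits into two levels. -/
theorem exists_equiv_energies_update (m : ℕ) (w : ℕ ⊕ ℕ → ℝ) :
    ∃ e : Fin (2 ^ (nB + m)) × Fin 2 ≃ Fin (2 ^ (nB + (m + 1))),
      ∀ x, energies hHB α (m + 1) (Function.update w (Sum.inr m) 0) (e x) =
        energies hHB α m w x.1 + zSign x.2 * w (Sum.inl m) := by
  refine exists_equiv_levels_of_blockDiagonal (n := nB + m) _ _ (w (Sum.inl m)) fun σ τ => ?_
  rw [hamiltonian_succ_apply]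
  simp only [Function.update_self, Complex.ofReal_zero, zero_mul, add_zero]
  rw [hamiltonian_congr (HB := HB) α (m := m) (h' := fun i => w (Sum.inl i))
    (g' := fun i => w (Sum.inr i))]
  · simp
  · intro i _
    simp
  · intro i hi
    rw [Function.update_of_ne]
    simpa using hi.ne

theorem hamiltonian_update_eq (m : ℕ) (w : ℕ ⊕ ℕ → ℝ) (y : ℝ) :
    hamiltonian HB α (fun i => Function.update w (Sum.inr m) y (Sum.inl i))
        (fun i => Function.update w (Sum.inr m) y (Sum.inr i)) (m + 1) =
      hamiltonian HB α (fun i => Function.update w (Sum.inr m) 0 (Sum.inl i))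
        (fun i => Function.update w (Sum.inr m) 0 (Sum.inr i)) (m + 1) +
      (y : ℂ) • (((α ^ (nB + m + 1) : ℝ) : ℂ) • couplingOp nB m) := by
  ext σ τ
  rw [Matrix.add_apply, hamiltonian_succ_apply, hamiltonian_succ_apply]
  rw [hamiltonian_congr (HB := HB) α (m := m)
    (h := fun i => Function.update w (Sum.inr m) y (Sum.inl i))
    (g := fun i => Function.update w (Sum.inr m) y (Sum.inr i))
    (h' := fun i => Function.update w (Sum.inr m) 0 (Sum.inl i))
    (g' := fun i => Function.update w (Sum.inr m) 0 (Sum.inr i))]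
  · simp
  · intro i _
    simp
  · intro i hi
    have : (Sum.inr i : ℕ ⊕ ℕ) ≠ Sum.inr m := by simpa using hi.ne
    simp only [Function.update_of_ne this]

theorem abs_energies_update_sub_le {α : ℝ} (hα : 0 ≤ α) (m : ℕ) (w : ℕ ⊕ ℕ → ℝ) (y : ℝ)
    (i : Fin (2 ^ (nB + (m + 1)))) :
    |energies hHB α (m + 1) (Function.update w (Sum.inr m) y) i -
      energies hHB α (m + 1) (Function.update w (Sum.inr m) 0) i| ≤
        α ^ (nB + m + 1) * 4 ^ (nB + m + 1) * |y| := by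
  refine (abs_levels_sub_le _ _ i).trans ?_
  rw [hamiltonian_update_eq]
  simp only [Matrix.add_apply, add_sub_cancel_left, Matrix.smul_apply, smul_eq_mul, norm_mul,
    Complex.norm_real, Real.norm_eq_abs, abs_pow, abs_of_nonneg hα]
  simp only [← Finset.mul_sum]
  have h1 := sum_norm_couplingOp_le nB m
  calc |y| * (α ^ (nB + m + 1) * ∑ σ, ∑ τ, ‖couplingOp nB m σ τ‖)
      ≤ |y| * (α ^ (nB + m + 1) * 4 ^ (nB + (m + 1))) := by gcongr
    _ = _ := by rw [← add_assoc]; ring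

open Polynomial in
theorem exists_energies_discriminant_polynomial (m : ℕ) (w : ℕ ⊕ ℕ → ℝ) :
    ∃ p : ℂ[X], p.natDegree ≤ 2 * 4 ^ (nB + m + 1) ∧ ∀ y : ℝ,
      ‖p.eval (y : ℂ)‖ = ∏ i, ∏ j ∈ ({i}ᶜ : Finset (Fin (2 ^ (nB + (m + 1))))),
        |energies hHB α (m + 1) (Function.update w (Sum.inr m) y) i -
          energies hHB α (m + 1) (Function.update w (Sum.inr m) y) j| := by
  obtain ⟨p, hp, hpe⟩ := exists_discriminant_polynomial (n := nB + (m + 1))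
    (hamiltonian HB α (fun i => Function.update w (Sum.inr m) 0 (Sum.inl i))
        (fun i => Function.update w (Sum.inr m) 0 (Sum.inr i)) (m + 1))
    (((α ^ (nB + m + 1) : ℝ) : ℂ) • couplingOp nB m) fun y => by
      rw [← hamiltonian_update_eq]
      exact hamiltonian_isHermitian hHB _ _ _ _
  refine ⟨p, hp, fun y => ?_⟩
  have h1 : energies hHB α (m + 1) (Function.update w (Sum.inr m) y) = levels (n := nB + (m + 1)) _ :=
    levels_congr _ (by
      rw [← hamiltonian_update_eq]
      exact hamiltonian_isHermitian hHB _ _ _ _) (hamiltonian_update_eq (HB := HB) α m w y)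
  rw [hpe, h1]

end Energies

/-! ### Close pairs of levels -/

section ClosePairs

theorem injective_of_split {ι κ : Type*} {E : ι → ℝ} (hE : Function.Injective E) {x : κ → ℝ} {c : ℝ}
    (e : ι × Fin 2 ≃ κ) (he : ∀ a, x (e a) = E a.1 + zSign a.2 * c)
    (hc : ∀ a b, E a - E b + 2 * c ≠ 0) : Function.Injective x := by
  intro i j hij
  obtain ⟨⟨a, s⟩, rfl⟩ := e.surjective i
  obtain ⟨⟨b, t⟩, rfl⟩ := e.surjective j
  rw [he, he] at hij
  have h1 := hc a b
  have h2 := hc b a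
  have hst : s = t := by
    by_contra hst
    have : zSign s = 1 ∧ zSign t = -1 ∨ zSign s = -1 ∧ zSign t = 1 := by
      fin_cases s <;> fin_cases t <;> simp_all [zSign]
    rcases this with ⟨hs, ht⟩ | ⟨hs, ht⟩
    · simp only [hs, ht] at hij
      exact h1 (by linarith)
    · simp only [hs, ht] at hij
      exact h2 (by linarith)
  subst hst
  have : a = b := hE (by simpa using hij)
  rw [this]

theorem abs_sub_sub_abs_sub_le {ι : Type*} {x y : ι → ℝ} {s : ℝ} (h : ∀ i, |y i - x i| ≤ s) (i j : ι) :
    |y i - y j| ≤ |x i - x j| + 2 * s := by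
  have h1 := h i
  have h2 := h j
  calc |y i - y j| = |(x i - x j) + (y i - x i) - (y j - x j)| := by ring_nf
    _ ≤ |x i - x j| + |y i - x i| + |y j - x j| :=
      (abs_sub _ _).trans (add_le_add_left (abs_add_le _ _) _)
    _ ≤ _ := by linarith

variable {ι κ : Type*} [Fintype ι] [DecidableEq ι] [Fintype κ] [DecidableEq κ]

/-- The ordered pairs of distinct indices whose levels differ by at most `ε`. -/
noncomputable def closePairs (E : ι → ℝ) (ε : ℝ) : Finset (ι × ι) :=
  Finset.univ.filter fun x => x.1 ≠ x.2 ∧ |E x.1 - E x.2| ≤ ε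

theorem mem_closePairs {E : ι → ℝ} {ε : ℝ} {x : ι × ι} :
    x ∈ closePairs E ε ↔ x.1 ≠ x.2 ∧ |E x.1 - E x.2| ≤ ε := by
  simp [closePairs]

/-- The logarithmic cost of the close pairs of levels. -/
noncomputable def closeCost (E : ι → ℝ) (ε : ℝ) : ℝ :=
  ∑ x ∈ closePairs E ε, -Real.log |E x.1 - E x.2|

theorem closeCost_nonneg (E : ι → ℝ) {ε : ℝ} (hε : ε ≤ 1) : 0 ≤ closeCost E ε :=
  Finset.sum_nonneg fun _ hx => neg_nonneg.mpr
    (Real.log_nonpos (abs_nonneg _) ((mem_closePairs.mp hx).2.trans hε))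

/-- Injectivity is essential: since `Real.log 0 = 0`, a coinciding pair would have no cost. This is
why simplicity of the spectrum is carried along almost surely. -/
theorem card_closePairs_mul_le_closeCost {E : ι → ℝ} (hE : Function.Injective E) (ε : ℝ) :
    (closePairs E ε).card * (-Real.log ε) ≤ closeCost E ε := by
  rw [← nsmul_eq_mul]
  refine Finset.card_nsmul_le_sum _ _ _ fun x hx => ?_
  obtain ⟨hne, hle⟩ := mem_closePairs.mp hx
  exact neg_le_neg (Real.log_le_log (abs_pos.mpr (sub_ne_zero.mpr (hE.ne hne))) hle)

theorem closePairs_subset_of_abs_sub_le {x y : ι → ℝ} {s ε ε' : ℝ} (h : ∀ i, |y i - x i| ≤ s)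
    (hε : ε' + 2 * s ≤ ε) : closePairs y ε' ⊆ closePairs x ε := by
  intro p hp
  rw [mem_closePairs] at hp ⊢
  refine ⟨hp.1, ?_⟩
  have h1 := abs_le.mp (h p.1)
  have h2 := abs_le.mp (h p.2)
  have h3 := abs_le.mp hp.2
  rw [abs_le]
  constructor <;> linarith

/-- Two levels with opposite values of the new spin are at least δ > ε apart. Hence the close pairs
are the old ones, with unchanged gaps, once for each value of the new spin. The general `F` serves
both the count and the cost. -/
theorem sum_closePairs_of_split {E : ι → ℝ} {x : κ → ℝ} {c δ ε : ℝ} (e : ι × Fin 2 ≃ κ)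
    (he : ∀ a, x (e a) = E a.1 + zSign a.2 * c) (hδ : ∀ a b, δ ≤ |E a - E b + 2 * c|)
    (hε : ε < δ) (F : ℝ → ℝ) :
    ∑ p ∈ closePairs x ε, F (x p.1 - x p.2) = 2 * ∑ p ∈ closePairs E ε, F (E p.1 - E p.2) := by
  let φ : (ι × ι) × Fin 2 → κ × κ := fun z => (e (z.1.1, z.2), e (z.1.2, z.2))
  have hφ : Function.Injective φ := by
    rintro ⟨⟨a, b⟩, s⟩ ⟨⟨a', b'⟩, s'⟩ h
    simp only [φ, Prod.mk.injEq, EmbeddingLike.apply_eq_iff_eq] at h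
    obtain ⟨⟨rfl, rfl⟩, rfl, -⟩ := h
    rfl
  have himage : closePairs x ε = (closePairs E ε ×ˢ (Finset.univ : Finset (Fin 2))).image φ := by
    ext ⟨i, j⟩
    obtain ⟨⟨a, s⟩, rfl⟩ := e.surjective i
    obtain ⟨⟨b, t⟩, rfl⟩ := e.surjective j
    simp only [mem_closePairs, he, Finset.mem_image, Finset.mem_product, Finset.mem_univ, and_true,
      Prod.exists, φ, Prod.mk.injEq, EmbeddingLike.apply_eq_iff_eq, ne_eq]
    constructor
    · rintro ⟨hne, hle⟩
      have hst : s = t := by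
        by_contra hst
        have h1 := hδ a b
        have h2 := hδ b a
        rw [abs_sub_comm] at hle
        rw [← abs_neg] at h1
        have : zSign s = 1 ∧ zSign t = -1 ∨ zSign s = -1 ∧ zSign t = 1 := by
          fin_cases s <;> fin_cases t <;> simp_all [zSign]
        rcases this with ⟨hs, ht⟩ | ⟨hs, ht⟩
        · rw [hs, ht] at hle
          rw [show E b + -1 * c - (E a + 1 * c) = -(E a - E b + 2 * c) by ring] at hle
          linarith
        · rw [hs, ht] at hle
          rw [show E b + 1 * c - (E a + -1 * c) = E b - E a + 2 * c by ring] at hle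
          linarith
      subst hst
      refine ⟨a, b, s, ⟨fun hab => hne ⟨hab, rfl⟩, ?_⟩, ⟨rfl, rfl⟩, rfl, rfl⟩
      rwa [add_sub_add_right_eq_sub] at hle
    · rintro ⟨a', b', s', ⟨hne, hle⟩, ⟨rfl, rfl⟩, rfl, rfl⟩
      refine ⟨fun h => hne h.1, ?_⟩
      rwa [add_sub_add_right_eq_sub]
  rw [himage, Finset.sum_image hφ.injOn, Finset.sum_product, Finset.mul_sum]
  refine Finset.sum_congr rfl fun p _ => ?_
  simp only [φ, he, add_sub_add_right_eq_sub]
  simp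

theorem prod_compl_eq_prod_filter (f : ι → ι → ℝ) :
    ∏ i, ∏ j ∈ ({i}ᶜ : Finset ι), f i j =
      ∏ p ∈ (Finset.univ : Finset (ι × ι)).filter (fun p => p.1 ≠ p.2), f p.1 p.2 := by
  rw [Finset.prod_filter, Fintype.prod_prod_type]
  refine Finset.prod_congr rfl fun i _ => ?_
  rw [← Finset.prod_filter]
  refine Finset.prod_congr ?_ fun _ _ => rfl
  ext j
  simp [eq_comm]

theorem closeCost_eq_sum_filter_ne (E : ι → ℝ) (ε : ℝ) :
    closeCost E ε = ∑ p ∈ (Finset.univ : Finset (ι × ι)).filter (fun p => p.1 ≠ p.2),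
      if |E p.1 - E p.2| ≤ ε then -Real.log |E p.1 - E p.2| else 0 := by
  rw [← Finset.sum_filter, Finset.filter_filter]
  rfl

theorem card_filter_ne_le :
    ((((Finset.univ : Finset (ι × ι)).filter (fun p => p.1 ≠ p.2)).card : ℕ) : ℝ) ≤
      (Fintype.card ι : ℝ) ^ 2 := by
  have := Finset.card_filter_le (Finset.univ : Finset (ι × ι)) (fun p => p.1 ≠ p.2)
  rw [Finset.card_univ, Fintype.card_prod, ← pow_two] at this
  exact_mod_cast this

theorem le_mul_exp_of_le_add {u v b ε : ℝ} (hε : 0 < ε) (hv : ε ≤ v) (hb : 0 ≤ b)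
    (h : u ≤ v + b) : u ≤ v * Real.exp (b / ε) := by
  have h1 := Real.add_one_le_exp (b / ε)
  have h2 : b ≤ v * (b / ε) := by
    rw [mul_div_assoc', le_div_iff₀ hε]
    nlinarith
  nlinarith

/-- A gap above ε grows at most by the factor exp(2s/ε). A gap below ε stays at most 1, so its
growth is at most its inverse, whose logarithm is its share of the cost. -/
theorem prod_abs_sub_le {x y : ι → ℝ} (hx : Function.Injective x) {s ε : ℝ} (hs : 0 ≤ s)
    (hε : 0 < ε) (h : ∀ i, |y i - x i| ≤ s) (h1 : ε + 2 * s ≤ 1) :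
    ∏ i, ∏ j ∈ ({i}ᶜ : Finset ι), |y i - y j| ≤
      Real.exp (closeCost x ε + (Fintype.card ι : ℝ) ^ 2 * (2 * s / ε)) *
        ∏ i, ∏ j ∈ ({i}ᶜ : Finset ι), |x i - x j| := by
  rw [prod_compl_eq_prod_filter, prod_compl_eq_prod_filter]
  set S := (Finset.univ : Finset (ι × ι)).filter (fun p => p.1 ≠ p.2)
  have hsε : 0 ≤ 2 * s / ε := by positivity
  have key : ∀ p ∈ S, |y p.1 - y p.2| ≤
      Real.exp ((if |x p.1 - x p.2| ≤ ε then -Real.log |x p.1 - x p.2| else 0) + 2 * s / ε) *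
        |x p.1 - x p.2| := by
    intro p hp
    have hpos : 0 < |x p.1 - x p.2| :=
      abs_pos.mpr (sub_ne_zero.mpr (hx.ne (Finset.mem_filter.mp hp).2))
    have hle := abs_sub_sub_abs_sub_le h p.1 p.2
    split_ifs with hc
    · rw [Real.exp_add, Real.exp_neg, Real.exp_log hpos, mul_right_comm,
        inv_mul_cancel₀ hpos.ne', one_mul]
      exact (hle.trans (by linarith)).trans (Real.one_le_exp hsε)
    · rw [zero_add, mul_comm]
      exact le_mul_exp_of_le_add hε (not_le.mp hc).le (by positivity) hle
  refine (Finset.prod_le_prod (fun _ _ => abs_nonneg _) key).trans ?_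
  rw [Finset.prod_mul_distrib, ← Real.exp_sum]
  refine mul_le_mul_of_nonneg_right (Real.exp_le_exp.mpr ?_)
    (Finset.prod_nonneg fun _ _ => abs_nonneg _)
  rw [Finset.sum_add_distrib, ← closeCost_eq_sum_filter_ne, Finset.sum_const, nsmul_eq_mul]
  have := mul_le_mul_of_nonneg_right (card_filter_ne_le (ι := ι)) hsε
  linarith

/-- Compare pair by pair. If a pair is close for `x`, the two logarithms of the `x`-gap cancel on
the right and the nonnegative -log of the `y`-gap remains. Otherwise the pair is not close for `y`,
and its gap has grown at most by the factor exp(2s/ε). Summation replaces the unwieldy cost by the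
logarithm of one polynomial. -/
theorem closeCost_le_of_abs_sub_le {x y : ι → ℝ} (hx : Function.Injective x)
    (hy : Function.Injective y) {s ε ε' : ℝ} (hs : 0 ≤ s) (hε : 0 < ε) (h : ∀ i, |y i - x i| ≤ s)
    (h1 : ε + 2 * s ≤ 1) (hε' : ε' + 2 * s ≤ ε) :
    closeCost y ε' ≤ closeCost x ε + (Fintype.card ι : ℝ) ^ 2 * (2 * s / ε) +
      (Real.log (∏ i, ∏ j ∈ ({i}ᶜ : Finset ι), |x i - x j|) -
        Real.log (∏ i, ∏ j ∈ ({i}ᶜ : Finset ι), |y i - y j|)) := by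
  rw [prod_compl_eq_prod_filter, prod_compl_eq_prod_filter, closeCost_eq_sum_filter_ne,
    closeCost_eq_sum_filter_ne]
  set S := (Finset.univ : Finset (ι × ι)).filter (fun p => p.1 ≠ p.2)
  have hsε : 0 ≤ 2 * s / ε := by positivity
  have hxpos : ∀ p ∈ S, 0 < |x p.1 - x p.2| := fun p hp =>
    abs_pos.mpr (sub_ne_zero.mpr (hx.ne (Finset.mem_filter.mp hp).2))
  have hypos : ∀ p ∈ S, 0 < |y p.1 - y p.2| := fun p hp =>
    abs_pos.mpr (sub_ne_zero.mpr (hy.ne (Finset.mem_filter.mp hp).2))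
  rw [Real.log_prod fun p hp => (hxpos p hp).ne', Real.log_prod fun p hp => (hypos p hp).ne']
  have key : ∀ p ∈ S, (if |y p.1 - y p.2| ≤ ε' then -Real.log |y p.1 - y p.2| else 0) ≤
      (if |x p.1 - x p.2| ≤ ε then -Real.log |x p.1 - x p.2| else 0) + 2 * s / ε +
        (Real.log |x p.1 - x p.2| - Real.log |y p.1 - y p.2|) := by
    intro p hp
    have hle := abs_sub_sub_abs_sub_le h p.1 p.2
    by_cases hc : |x p.1 - x p.2| ≤ ε
    · rw [if_pos hc]
      have hlog := Real.log_nonpos (hypos p hp).le (hle.trans (by linarith))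
      split_ifs <;> linarith
    · have hc' : ¬ |y p.1 - y p.2| ≤ ε' := by
        intro hy'
        have hmem : p ∈ closePairs y ε' := mem_closePairs.mpr ⟨(Finset.mem_filter.mp hp).2, hy'⟩
        exact hc (mem_closePairs.mp (closePairs_subset_of_abs_sub_le h hε' hmem)).2
      rw [if_neg hc, if_neg hc']
      have h2 := Real.log_le_log (hypos p hp)
        (le_mul_exp_of_le_add hε (not_le.mp hc).le (by positivity) hle)
      rw [Real.log_mul (hxpos p hp).ne' (Real.exp_pos _).ne', Real.log_exp] at h2
      linarith
  refine (Finset.sum_le_sum key).trans ?_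
  rw [Finset.sum_add_distrib, Finset.sum_add_distrib, Finset.sum_sub_distrib, Finset.sum_const,
    nsmul_eq_mul]
  have := mul_le_mul_of_nonneg_right (card_filter_ne_le (ι := ι)) hsε
  linarith

theorem prod_compl_abs_sub_ne_zero_iff (E : ι → ℝ) :
    ∏ i, ∏ j ∈ ({i}ᶜ : Finset ι), |E i - E j| ≠ 0 ↔ Function.Injective E := by
  rw [Finset.prod_ne_zero_iff]
  constructor
  · intro h i j hij
    by_contra hne
    refine Finset.prod_ne_zero_iff.mp (h i (Finset.mem_univ i)) j ?_ ?_
    · simpa using Ne.symm hne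
    · rw [hij, sub_self, abs_zero]
  · intro hinj i _
    refine Finset.prod_ne_zero_iff.mpr fun j hj => abs_ne_zero.mpr (sub_ne_zero.mpr (hinj.ne ?_))
    rintro rfl
    simp at hj

open Polynomial in
/-- The average cost of the close pairs of a one-parameter family of levels. -/
theorem lintegral_closeCost_le {y : ℝ → ι → ℝ} {p : ℂ[X]} {d : ℕ} (hd : p.natDegree ≤ d)
    (hp : ∀ t : ℝ, ‖p.eval (t : ℂ)‖ = ∏ i, ∏ j ∈ ({i}ᶜ : Finset ι), |y t i - y t j|)
    (h0 : Function.Injective (y 0)) {β ε ε' R r ρ : ℝ} (hβ : 0 ≤ β)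
    (hy : ∀ t i, |y t i - y 0 i| ≤ β * |t|) (hε : 0 < ε) (hr : 1 ≤ r) (hrρ : 2 * r < ρ)
    (hρR : 2 * ρ ≤ R) (hR1 : ε + 2 * (β * R) ≤ 1) (hε' : ε' + β ≤ ε) :
    ∫⁻ t in Set.Icc (-1 / 2 : ℝ) (1 / 2), ENNReal.ofReal (closeCost (y t) ε') ≤
      ENNReal.ofReal (closeCost (y 0) ε + (Fintype.card ι : ℝ) ^ 2 * (β / ε) + d / r +
        3 * ((closeCost (y 0) ε + (Fintype.card ι : ℝ) ^ 2 * (2 * (β * R) / ε) +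
          2 * d * (ρ / R)) / Real.log (ρ / r - 1))) := by
  have hprod0 : ∀ t, Function.Injective (y t) ↔ p.eval (t : ℂ) ≠ 0 := by
    intro t
    rw [← norm_ne_zero_iff, hp, prod_compl_abs_sub_ne_zero_iff]
  have hp0 : p.eval 0 ≠ 0 := by
    have := (hprod0 0).mp h0
    simpa using this
  have hRpos : 0 ≤ R := by linarith
  have hgrowth : ∀ t : ℝ, |t| ≤ R → ‖p.eval (t : ℂ)‖ ≤
      Real.exp (closeCost (y 0) ε + (Fintype.card ι : ℝ) ^ 2 * (2 * (β * R) / ε)) *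
        ‖p.eval 0‖ := by
    intro t ht
    have h2 := hp 0
    rw [Complex.ofReal_zero] at h2
    rw [hp t, h2]
    exact prod_abs_sub_le h0 (mul_nonneg hβ hRpos) hε
      (fun i => (hy t i).trans (mul_le_mul_of_nonneg_left ht hβ)) hR1
  have hβR : β ≤ β * R := by nlinarith
  have hε1 : ε ≤ 1 := by nlinarith [mul_nonneg hβ hRpos]
  have hc : 0 ≤ closeCost (y 0) ε + (Fintype.card ι : ℝ) ^ 2 * (β / ε) := by
    have := closeCost_nonneg (y 0) hε1
    positivity
  refine le_trans (lintegral_mono_ae ?_)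
    (lintegral_log_norm_eval_le hp0 hd hr hrρ hρR hc hgrowth)
  have hpne : p ≠ 0 := by
    rintro rfl
    simp at hp0
  rw [ae_restrict_iff' measurableSet_Icc]
  have hfin : (↑(p.roots.toFinset.image Complex.re) : Set ℝ).Finite := Finset.finite_toSet _
  filter_upwards [hfin.measure_zero volume |> compl_mem_ae_iff.mpr] with t ht htI
  refine ENNReal.ofReal_le_ofReal ?_
  have hpt : p.eval (t : ℂ) ≠ 0 := by
    intro h
    refine ht ?_
    simp only [Finset.coe_image, Set.mem_image, Finset.mem_coe, Multiset.mem_toFinset]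
    exact ⟨t, (mem_roots hpne).mpr h, rfl⟩
  have h2 := hp 0
  rw [Complex.ofReal_zero] at h2
  rw [h2, hp t]
  have ht2 : |t| ≤ 1 / 2 := abs_le.mpr ⟨by linarith [htI.1], htI.2⟩
  -- Only |t| ≤ 1/2 matters here, so the shift is `β / 2`; the long range `R` enters through the
  -- growth bound alone.
  have h3 := closeCost_le_of_abs_sub_le h0 ((hprod0 t).mpr hpt) (s := β / 2) (by positivity) hε
    (fun i => (hy t i).trans (by nlinarith)) (ε' := ε') (by linarith) (by linarith)
  rwa [show 2 * (β / 2) / ε = β / ε by ring] at h3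

end ClosePairs

/-! ### The effect of one more spin on the close pairs -/

section OneStep

theorem exp_neg_twentyfour_le : Real.exp (-24) ≤ 1 / 1000 := by
  have h1 : (2 : ℝ) ≤ Real.exp 1 := by linarith [Real.add_one_le_exp (1 : ℝ)]
  have h2 : Real.exp 24 = Real.exp 1 ^ 24 := by rw [← Real.exp_nat_mul]; norm_num
  rw [Real.exp_neg, inv_le_comm₀ (Real.exp_pos _) (by norm_num), h2]
  calc ((1 : ℝ) / 1000)⁻¹ ≤ 2 ^ 24 := by norm_num
    _ ≤ _ := pow_le_pow_left₀ (by norm_num) h1 24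

/-- Half of the exponent 24 is given away to absorb the `- 1`. The remaining 12, against the factor
3 for the average cost of a zero, yields the relative increase `1 / (4 * n)` of one step. -/
theorem le_log_inv_pow_sub_one {q : ℝ} (hq0 : 0 < q) (hq : q ≤ Real.exp (-24)) {n : ℕ}
    (hn : 1 ≤ n) : 12 * (n : ℝ) ≤ Real.log (q⁻¹ ^ n - 1) := by
  have h1 : Real.exp 24 ≤ q⁻¹ := by
    rw [Real.exp_neg] at hq
    exact (le_inv_comm₀ hq0 (Real.exp_pos _)).mp hq
  have h2 : Real.exp (12 * n) ^ 2 ≤ q⁻¹ ^ n := by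
    have : Real.exp (12 * n) ^ 2 = Real.exp 24 ^ n := by
      rw [← Real.exp_nat_mul, ← Real.exp_nat_mul]
      congr 1
      push_cast
      ring
    rw [this]
    exact pow_le_pow_left₀ (Real.exp_pos _).le h1 n
  have h3 : 2 ≤ Real.exp (12 * n) := by
    have h4 := Real.add_one_le_exp (12 * (n : ℝ))
    have h5 : (1 : ℝ) ≤ n := by exact_mod_cast hn
    linarith
  have h6 : Real.exp (12 * n) ≤ q⁻¹ ^ n - 1 := by nlinarith
  rw [Real.le_log_iff_exp_le (by linarith)]
  exact h6

variable {nB : ℕ} {HB : Op nB} (hHB : HB.IsHermitian)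

/-- The new spin is not resonant with any transition between the levels of the old spins. -/
def NonResonant (α : ℝ) (m : ℕ) (w : ℕ ⊕ ℕ → ℝ) : Prop :=
  ∀ i j, (1 / 8 : ℝ) ^ (nB + m) ≤
    |energies hHB α m w i - energies hHB α m w j + 2 * w (Sum.inl m)|

theorem pow_lt_eighth_pow {a : ℝ} (ha0 : 0 < a) (ha : a ≤ 1 / 16) {n : ℕ} (hn : 1 ≤ n) :
    a ^ n < (1 / 8 : ℝ) ^ n :=
  pow_lt_pow_left₀ (by linarith) ha0.le (by omega)

theorem coupling_le {a q : ℝ} (ha0 : 0 < a) (ha : a ≤ 1 / 16) (hq0 : 0 < q) (hq : q ≤ 1 / 1000)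
    (n : ℕ) : (a * q ^ 6) ^ (n + 1) * 4 ^ (n + 1) ≤ a ^ n * (1 / 4) := by
  have h1 : (a * q ^ 6) ^ (n + 1) * 4 ^ (n + 1) =
      a ^ n * ((4 * a) * q ^ 6 * (4 * q ^ 6) ^ n) := by
    rw [pow_succ, pow_succ, mul_pow, mul_pow]
    ring
  rw [h1]
  have h2 : q ^ 6 ≤ 1 / 4 := (pow_le_pow_left₀ hq0.le hq 6).trans (by norm_num)
  have h3 : (4 * q ^ 6) ^ n ≤ 1 := pow_le_one₀ (by positivity) (by linarith)
  have h4 : 4 * a * q ^ 6 ≤ 1 / 4 := by nlinarith [pow_pos hq0 6]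
  refine mul_le_mul_of_nonneg_left ?_ (pow_pos ha0 n).le
  calc 4 * a * q ^ 6 * (4 * q ^ 6) ^ n ≤ 1 / 4 * 1 :=
        mul_le_mul h4 h3 (by positivity) (by norm_num)
    _ = 1 / 4 := by norm_num

/-- The threshold shrinks by the factor `a` at each step, which leaves more room than the coupling
can use: a pair within `a ^ (n + 1)` after coupling was within `a ^ n` before it, and those pairs
have doubled. -/
theorem card_closePairs_succ_le {a q : ℝ} (ha0 : 0 < a) (ha : a ≤ 1 / 16) (hq0 : 0 < q)
    (hq : q ≤ Real.exp (-24)) {m : ℕ} (hn : 1 ≤ nB + m) {w : ℕ ⊕ ℕ → ℝ}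
    (hw : NonResonant hHB (a * q ^ 6) m w) (hg : |w (Sum.inr m)| ≤ 1 / 2) :
    (closePairs (energies hHB (a * q ^ 6) (m + 1) w) (a ^ (nB + (m + 1)))).card ≤
      2 * (closePairs (energies hHB (a * q ^ 6) m w) (a ^ (nB + m))).card := by
  obtain ⟨e, he⟩ := exists_equiv_energies_update hHB (a * q ^ 6) m w
  have hα : 0 ≤ a * q ^ 6 := by positivity
  have hshift := fun i => abs_energies_update_sub_le hHB hα m w (w (Sum.inr m)) i
  rw [Function.update_eq_self] at hshift
  have hc := coupling_le ha0 ha hq0 (hq.trans exp_neg_twentyfour_le) (nB + m)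
  have hsub := closePairs_subset_of_abs_sub_le
    (x := energies hHB (a * q ^ 6) (m + 1) (Function.update w (Sum.inr m) 0))
    (s := a ^ (nB + m) * (1 / 4) * (1 / 2)) (ε := a ^ (nB + m)) (ε' := a ^ (nB + (m + 1)))
    (fun i => (hshift i).trans (mul_le_mul hc hg (abs_nonneg _) (by positivity))) (by
      rw [← add_assoc, pow_succ]
      nlinarith [pow_pos ha0 (nB + m)])
  refine (Finset.card_le_card hsub).trans (le_of_eq ?_)
  have h2 := sum_closePairs_of_split e he hw (pow_lt_eighth_pow ha0 ha hn) fun _ => 1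
  simp only [Finset.sum_const, nsmul_eq_mul, mul_one] at h2
  exact_mod_cast h2

/-- With Q = q^(-n) the three radii are Q, Q², Q³. Each ratio is Q, large enough to beat the degree
of order 4^n and to make log(Q - 1) at least 12n. The coupling still perturbs the levels by less
than a^n/4 over the longest range, since q^(6n) pays for Q³ and leaves q^(3n) against the remaining
factor 16^n. -/
theorem lintegral_closeCost_succ_le {a q : ℝ} (ha0 : 0 < a) (ha : a ≤ 1 / 16) (hq0 : 0 < q)
    (hq : q ≤ Real.exp (-24)) {m : ℕ} (hn : 1 ≤ nB + m) {w : ℕ ⊕ ℕ → ℝ}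
    (hw : NonResonant hHB (a * q ^ 6) m w)
    (hinj : Function.Injective (energies hHB (a * q ^ 6) m w)) :
    ∫⁻ t in Set.Icc (-1 / 2 : ℝ) (1 / 2), ENNReal.ofReal
      (closeCost (energies hHB (a * q ^ 6) (m + 1) (Function.update w (Sum.inr m) t))
        (a ^ (nB + (m + 1)))) ≤
    ENNReal.ofReal (2 * (1 + 1 / (4 * ((nB + m : ℕ) : ℝ))) *
      closeCost (energies hHB (a * q ^ 6) m w) (a ^ (nB + m)) + 3) := by
  obtain ⟨e, he⟩ := exists_equiv_energies_update hHB (a * q ^ 6) m w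
  obtain ⟨p, hpdeg, hp⟩ := exists_energies_discriminant_polynomial hHB (a * q ^ 6) m w
  have hα : 0 ≤ a * q ^ 6 := by positivity
  have hq3 : q ≤ 1 / 1000 := hq.trans exp_neg_twentyfour_le
  have hlog := le_log_inv_pow_sub_one hq0 hq hn
  have hlt := pow_lt_eighth_pow ha0 ha hn
  have h0inj : Function.Injective
      (energies hHB (a * q ^ 6) (m + 1) (Function.update w (Sum.inr m) 0)) :=
    injective_of_split hinj e he fun i j h => by
      have := hw i j
      rw [h, abs_zero] at this
      exact absurd this (not_le.mpr (by positivity))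
  have hcost : closeCost (energies hHB (a * q ^ 6) (m + 1) (Function.update w (Sum.inr m) 0))
      (a ^ (nB + m)) = 2 * closeCost (energies hHB (a * q ^ 6) m w) (a ^ (nB + m)) :=
    sum_closePairs_of_split e he hw hlt fun z => -Real.log |z|
  set n := nB + m with hndef
  have hn0 : n ≠ 0 := by omega
  set Λ := closeCost (energies hHB (a * q ^ 6) m w) (a ^ n)
  set β := (a * q ^ 6) ^ (n + 1) * 4 ^ (n + 1) with hβ
  have ha1 : a ^ n ≤ 1 / 16 := (pow_le_of_le_one ha0.le (by linarith) hn0).trans ha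
  have hΛ : 0 ≤ Λ := closeCost_nonneg _ (by linarith)
  have hβ0 : 0 ≤ β := by positivity
  have hβle := coupling_le ha0 ha hq0 hq3 n
  have hQ : 1000 ≤ q⁻¹ ^ n := by
    have h1 : 1000 ≤ q⁻¹ := by
      rw [le_inv_comm₀ (by norm_num) hq0]
      linarith
    exact h1.trans (le_self_pow₀ (by linarith) hn0)
  have hqn : q⁻¹ ^ n * q ^ n = 1 := by
    rw [← mul_pow, inv_mul_cancel₀ hq0.ne', one_pow]
  set Q := q⁻¹ ^ n with hQdef
  have hQ0 : Q ≠ 0 := by positivity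
  have hqn0 : 0 < q ^ n := pow_pos hq0 n
  have hqQ : q ^ n = Q⁻¹ := by rw [eq_inv_of_mul_eq_one_right hqn]
  have hQ2 : Q ^ 2 / Q = Q := by field_simp
  have h4q : 4 ^ n * q ^ n ≤ 4 * (1 / 1000) := by
    rw [← mul_pow]
    exact (pow_le_of_le_one (by positivity) (by linarith) hn0).trans (by linarith)
  -- the coupling is small, even after multiplication by `Q ^ 3`
  have hβR : β * Q ^ 3 * 4 ^ (n + 1) ≤ a ^ n * (1 / 4) := by
    have h1 : β * Q ^ 3 * 4 ^ (n + 1) = a ^ n * ((16 * a) * q ^ 6 * (16 * q ^ 3) ^ n) := by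
      have h2 : (q ^ 6) ^ n * Q ^ 3 = (q ^ 3) ^ n := by
        rw [pow_right_comm q 6 n, pow_right_comm q 3 n, hqQ]
        field_simp
      calc β * Q ^ 3 * 4 ^ (n + 1)
          = a ^ n * a * q ^ 6 * (4 * 4) * (4 ^ n * 4 ^ n) * ((q ^ 6) ^ n * Q ^ 3) := by
            rw [hβ, pow_succ, pow_succ, mul_pow]
            ring
        _ = _ := by
            rw [h2, ← mul_pow (4 : ℝ), mul_pow (16 : ℝ)]
            norm_num
            ring
    rw [h1]
    have h2 : q ^ 6 ≤ 1 / 4 := (pow_le_pow_left₀ hq0.le hq3 6).trans (by norm_num)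
    have h3 : q ^ 3 ≤ 1 / 16 := (pow_le_pow_left₀ hq0.le hq3 3).trans (by norm_num)
    have h4 : (16 * q ^ 3) ^ n ≤ 1 := pow_le_one₀ (by positivity) (by linarith)
    have h5 : 16 * a * q ^ 6 ≤ 1 / 4 := by nlinarith [pow_pos hq0 6]
    refine mul_le_mul_of_nonneg_left ?_ (pow_pos ha0 n).le
    calc 16 * a * q ^ 6 * (16 * q ^ 3) ^ n ≤ 1 / 4 * 1 :=
          mul_le_mul h5 h4 (by positivity) (by norm_num)
      _ = 1 / 4 := by norm_num
  have h4one : (1 : ℝ) ≤ 4 ^ (n + 1) := one_le_pow₀ (by norm_num)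
  have hβR1 : β * Q ^ 3 ≤ a ^ n * (1 / 4) := le_trans (le_mul_of_one_le_right (by positivity) h4one) hβR
  have han : 0 < a ^ n := pow_pos ha0 n
  have hmain := lintegral_closeCost_le hpdeg hp h0inj hβ0 (ε := a ^ n) (ε' := a ^ (nB + (m + 1)))
    (R := Q ^ 3) (r := Q) (ρ := Q ^ 2)
    (fun t i => abs_energies_update_sub_le hHB hα m w t i) han (by linarith)
    (by nlinarith) (by nlinarith [pow_pos (show 0 < Q by linarith) 2]) (by linarith) (by
      rw [← add_assoc, ← hndef, pow_succ]
      nlinarith)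
  refine hmain.trans (ENNReal.ofReal_le_ofReal ?_)
  rw [hcost, hQ2]
  have hcard : ((Fintype.card (Fin (2 ^ (nB + (m + 1)))) : ℕ) : ℝ) ^ 2 = 4 ^ (n + 1) := by
    rw [Fintype.card_fin, ← add_assoc, ← hndef]
    push_cast
    rw [← pow_mul, mul_comm, pow_mul]
    norm_num
  rw [hcard]
  have hQ3 : Q ^ 2 / Q ^ 3 = q ^ n := by
    rw [hqQ]
    field_simp
  have hd : ((2 * 4 ^ (n + 1) : ℕ) : ℝ) / Q = 8 * (4 ^ n * q ^ n) := by
    rw [div_eq_mul_inv, ← hqQ]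
    push_cast
    ring
  have hd2 : 2 * ((2 * 4 ^ (n + 1) : ℕ) : ℝ) * q ^ n = 16 * (4 ^ n * q ^ n) := by
    push_cast
    ring
  rw [hQ3, hd, hd2]
  have e1 : (4 : ℝ) ^ (n + 1) * (β / a ^ n) ≤ 1 / 4 := by
    rw [mul_div_assoc', div_le_iff₀ han]
    have : 1 ≤ Q ^ 3 := one_le_pow₀ (by linarith)
    nlinarith [mul_nonneg hβ0 (show (0 : ℝ) ≤ 4 ^ (n + 1) by positivity)]
  have e2 : (4 : ℝ) ^ (n + 1) * (2 * (β * Q ^ 3) / a ^ n) ≤ 1 / 2 := by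
    rw [mul_div_assoc', div_le_iff₀ han]
    linarith
  have hnpos : (1 : ℝ) ≤ n := by exact_mod_cast hn
  have hX : (2 * Λ + 4 ^ (n + 1) * (2 * (β * Q ^ 3) / a ^ n) + 16 * (4 ^ n * q ^ n)) /
      Real.log (Q - 1) ≤ (2 * Λ + 1) / (12 * n) := by
    refine div_le_div₀ (by linarith) ?_ (by linarith) hlog
    linarith
  have hfin : 3 * ((2 * Λ + 1) / (12 * n)) ≤ 2 * Λ * (1 / (4 * n)) + 1 := by
    have : 3 * ((2 * Λ + 1) / (12 * n)) = 2 * Λ * (1 / (4 * n)) + 1 / (4 * n) := by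
      field_simp
      ring
    rw [this]
    have : 1 / (4 * (n : ℝ)) ≤ 1 := by
      rw [div_le_one (by linarith)]
      linarith
    linarith
  have : 2 * (1 + 1 / (4 * (n : ℝ))) * Λ + 3 = 2 * Λ + 2 * Λ * (1 / (4 * n)) + 3 := by ring
  rw [this]
  linarith

end OneStep

/-! ### Resampling one of several independent random variables -/

section Resampling

variable {Ω κ : Type*} [DecidableEq κ] {mΩ : MeasurableSpace Ω} {P : Measure Ω}
  [IsProbabilityMeasure P] {X : κ → Ω → ℝ}

/-- Fubini for the independent pair formed by the coordinates in `S` and `X k`. As `F` depends only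
on these, all other coordinates may be set to 0 to view it as a function of the pair. -/
theorem lintegral_eq_lintegral_lintegral_update (hX : ∀ k, Measurable (X k)) (hind : iIndepFun X P)
    {S : Finset κ} {k : κ} (hk : k ∉ S) {F : (κ → ℝ) → ENNReal} (hF : Measurable F)
    (hdep : ∀ w w' : κ → ℝ, (∀ i ∈ S, w i = w' i) → w k = w' k → F w = F w') :
    ∫⁻ ω, F (fun i => X i ω) ∂P =
      ∫⁻ ω, ∫⁻ t, F (Function.update (fun i => X i ω) k t) ∂(P.map (X k)) ∂P := by
  let V : Ω → S → ℝ := fun ω i => X i ω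
  let ext : (S → ℝ) → κ → ℝ := fun v i => if h : i ∈ S then v ⟨i, h⟩ else 0
  have hext : Measurable ext := by
    refine measurable_pi_lambda _ fun i => ?_
    by_cases h : i ∈ S
    · simp only [ext, h, dif_pos]
      exact measurable_pi_apply _
    · simp only [ext, h, dif_neg, not_false_eq_true]
      exact measurable_const
  let G : (S → ℝ) × ℝ → ENNReal := fun z => F (Function.update (ext z.1) k z.2)
  have hG : Measurable G := by
    refine hF.comp ?_
    refine measurable_pi_lambda _ fun i => ?_
    by_cases h : i = k
    · subst h
      simp only [Function.update_self]
      exact measurable_snd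
    · simp only [Function.update_of_ne h]
      exact (measurable_pi_apply i).comp (hext.comp measurable_fst)
  have hV : Measurable V := measurable_pi_lambda _ fun i => hX i
  have hVX : IndepFun V (X k) P :=
    (hind.indepFun_finset S {k} (Finset.disjoint_singleton_right.mpr hk) hX).comp measurable_id
      (measurable_pi_apply (⟨k, Finset.mem_singleton_self k⟩ : ({k} : Finset κ)))
  have hGF : ∀ ω t, G (V ω, t) = F (Function.update (fun i => X i ω) k t) := by
    intro ω t
    refine hdep _ _ (fun i hi => ?_) (by simp)
    have hik : i ≠ k := fun h => hk (h ▸ hi)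
    rw [Function.update_of_ne hik, Function.update_of_ne hik]
    simp [ext, V, hi]
  have h1 : ∀ ω, F (fun i => X i ω) = G (V ω, X k ω) := by
    intro ω
    rw [hGF]
    congr 1
    exact (Function.update_eq_self k (fun i => X i ω)).symm
  simp only [h1]
  rw [← lintegral_map (f := G) (g := fun ω => (V ω, X k ω)) hG (hV.prodMk (hX k)),
    (indepFun_iff_map_prod_eq_prod_map_map hV.aemeasurable (hX k).aemeasurable).mp hVX]
  have : SFinite (P.map (X k)) := inferInstance
  rw [lintegral_prod _ hG.aemeasurable, lintegral_map hG.lintegral_prod_right' hV]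
  simp only [hGF]

theorem measure_eq_lintegral_measure_update (hX : ∀ k, Measurable (X k)) (hind : iIndepFun X P)
    {S : Finset κ} {k : κ} (hk : k ∉ S) {A : Set (κ → ℝ)} (hA : MeasurableSet A)
    (hdep : ∀ w w' : κ → ℝ, (∀ i ∈ S, w i = w' i) → w k = w' k → w ∈ A → w' ∈ A) :
    P {ω | (fun i => X i ω) ∈ A} =
      ∫⁻ ω, P.map (X k) {t | Function.update (fun i => X i ω) k t ∈ A} ∂P := by
  have hW : Measurable fun ω i => X i ω := measurable_pi_lambda _ hX
  have h := lintegral_eq_lintegral_lintegral_update hX hind hk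
    (F := A.indicator 1) (measurable_one.indicator hA) fun w w' h1 h2 => by
      have : w ∈ A ↔ w' ∈ A :=
        ⟨hdep w w' h1 h2, hdep w' w (fun i hi => (h1 i hi).symm) h2.symm⟩
      by_cases hw : w ∈ A
      · rw [Set.indicator_of_mem hw, Set.indicator_of_mem (this.mp hw)]
        rfl
      · rw [Set.indicator_of_notMem hw, Set.indicator_of_notMem fun h => hw (this.mpr h)]
  have e1 : ∫⁻ ω, A.indicator (1 : (κ → ℝ) → ENNReal) (fun i => X i ω) ∂P =
      P {ω | (fun i => X i ω) ∈ A} := by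
    exact lintegral_indicator_one (hW hA)
  rw [← e1, h]
  exact lintegral_congr fun ω => lintegral_indicator_one (measurable_update _ hA)

theorem measure_le_of_forall_measure_update_le (hX : ∀ k, Measurable (X k)) (hind : iIndepFun X P)
    {S : Finset κ} {k : κ} (hk : k ∉ S) {A : Set (κ → ℝ)} (hA : MeasurableSet A)
    (hdep : ∀ w w' : κ → ℝ, (∀ i ∈ S, w i = w' i) → w k = w' k → w ∈ A → w' ∈ A) {c : ENNReal}
    (hc : ∀ w : κ → ℝ, P.map (X k) {t | Function.update w k t ∈ A} ≤ c) :
    P {ω | (fun i => X i ω) ∈ A} ≤ c := by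
  rw [measure_eq_lintegral_measure_update hX hind hk hA hdep]
  refine (lintegral_mono fun ω => hc _).trans (le_of_eq ?_)
  simp

end Resampling

/-! ### Almost sure properties of the spectrum -/

section AlmostSure

variable {nB : ℕ} {HB : Op nB} (hHB : HB.IsHermitian) (α : ℝ)

theorem hamiltonian_zero (h g : ℕ → ℝ) : hamiltonian HB α h g 0 = HB := by
  unfold hamiltonian
  rw [Finset.univ_eq_empty, Finset.sum_empty]
  refine (add_zero (bathOp 0 HB)).trans ?_
  ext σ τ
  exact if_pos fun j => j.elim0

theorem injective_energies_zero (hnd : NonDegenerate hHB) (w : ℕ ⊕ ℕ → ℝ) :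
    Function.Injective (energies hHB α 0 w) := by
  have h : energies hHB α 0 w = levels hHB := levels_congr (n := nB) _ _ (hamiltonian_zero α _ _)
  rw [h]
  intro i j hij
  by_contra hne
  have := hnd.1 i j hne
  rw [hij, sub_self, abs_zero] at this
  exact lt_irrefl _ this

theorem measurableSet_injective_energies (m : ℕ) :
    MeasurableSet {w | Function.Injective (energies hHB α m w)} := by
  simp only [Function.Injective, Set.ofPred_forall]
  refine MeasurableSet.iInter fun i => MeasurableSet.iInter fun j => ?_
  by_cases hij : i = j
  · simp [hij]
  · simp only [hij, imp_false]
    exact (measurableSet_eq_fun (measurable_energies hHB α m i)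
      (measurable_energies hHB α m j)).compl

theorem measurable_transition (m : ℕ) (i j : Fin (2 ^ (nB + m))) :
    Measurable fun w : ℕ ⊕ ℕ → ℝ =>
      energies hHB α m w i - energies hHB α m w j + 2 * w (Sum.inl m) :=
  ((measurable_energies hHB α m i).sub (measurable_energies hHB α m j)).add
    ((measurable_pi_apply _).const_mul 2)

theorem measurableSet_nonResonant (m : ℕ) : MeasurableSet {w | NonResonant hHB α m w} := by
  simp only [NonResonant, Set.ofPred_forall]
  exact MeasurableSet.iInter fun i => MeasurableSet.iInter fun j =>
    measurableSet_le measurable_const (measurable_transition hHB α m i j).norm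

theorem nonResonant_congr {m : ℕ} {w w' : ℕ ⊕ ℕ → ℝ}
    (hl : ∀ i < m + 1, w (Sum.inl i) = w' (Sum.inl i))
    (hr : ∀ i < m, w (Sum.inr i) = w' (Sum.inr i)) (h : NonResonant hHB α m w) :
    NonResonant hHB α m w' := by
  intro i j
  have := h i j
  rwa [energies_congr hHB α (fun i hi => hl i (by omega)) hr, hl m (by omega)] at this

variable {Ω : Type*} {mΩ : MeasurableSpace Ω} {P : Measure Ω} [IsProbabilityMeasure P]
  {X : ℕ ⊕ ℕ → Ω → ℝ}

/-- Given the earlier parameters, each equation is affine in the new field with slope 2, so it has a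
single solution. -/
theorem ae_transition_ne_zero (hX : ∀ k, Measurable (X k)) (hind : iIndepFun X P)
    (hlaw : ∀ k, P.map (X k) = volume.restrict (Set.Icc (-1 / 2 : ℝ) (1 / 2))) (m : ℕ) :
    ∀ᵐ ω ∂P, ∀ i j, energies hHB α m (fun k => X k ω) i - energies hHB α m (fun k => X k ω) j +
      2 * X (Sum.inl m) ω ≠ 0 := by
  rw [ae_all_iff]
  intro i
  rw [ae_all_iff]
  intro j
  rw [ae_iff]
  simp only [ne_eq, not_not]
  have hk : (Sum.inl m : ℕ ⊕ ℕ) ∉ (Finset.range m).disjSum (Finset.range m) := by simp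
  have hmeas := measurableSet_eq_fun (measurable_transition hHB α m i j)
    (measurable_const (a := (0 : ℝ)))
  refine le_antisymm (measure_le_of_forall_measure_update_le hX hind hk hmeas
    (fun w w' h1 h2 hw => ?_) fun w => ?_) (zero_le)
  · have hc : energies hHB α m w = energies hHB α m w' := energies_congr hHB α
      (fun i hi => h1 _ (by simpa using hi)) (fun i hi => h1 _ (by simpa using hi))
    change _ = _ at hw
    change _ = _
    rwa [← hc, ← h2]
  · have hc : ∀ t, energies hHB α m (Function.update w (Sum.inl m) t) = energies hHB α m w :=
      fun t => energies_congr hHB α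
        (fun i hi => Function.update_of_ne (by simpa using hi.ne) _ _)
        (fun i hi => Function.update_of_ne (by simp) _ _)
    have hsub : {t | Function.update w (Sum.inl m) t ∈ {w | energies hHB α m w i -
        energies hHB α m w j + 2 * w (Sum.inl m) = 0}} ⊆
        {-(energies hHB α m w i - energies hHB α m w j) / 2} := by
      intro t ht
      change _ = _ at ht
      rw [hc, Function.update_self] at ht
      rw [Set.mem_singleton_iff]
      linarith
    rw [hlaw]
    exact ((measure_mono hsub).trans (Measure.restrict_apply_le _ _)).trans (by simp)

/-- By induction: if the old spectrum is simple and no transition is exactly resonant, the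
discriminant is nonzero at `g = 0`, so as a polynomial in the new coupling it vanishes at finitely
many points only. -/
theorem ae_injective_energies (hnd : NonDegenerate hHB) (hX : ∀ k, Measurable (X k))
    (hind : iIndepFun X P)
    (hlaw : ∀ k, P.map (X k) = volume.restrict (Set.Icc (-1 / 2 : ℝ) (1 / 2))) (m : ℕ) :
    ∀ᵐ ω ∂P, Function.Injective (energies hHB α m fun k => X k ω) := by
  induction m with
  | zero => exact ae_of_all _ fun ω => injective_energies_zero hHB α hnd _
  | succ m ih =>
    let A : Set (ℕ ⊕ ℕ → ℝ) := ({w | Function.Injective (energies hHB α m w)} ∩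
      ⋂ i, ⋂ j, {w | energies hHB α m w i - energies hHB α m w j + 2 * w (Sum.inl m) = 0}ᶜ) ∩
      {w | Function.Injective (energies hHB α (m + 1) w)}ᶜ
    have hA : MeasurableSet A :=
      ((measurableSet_injective_energies hHB α m).inter (MeasurableSet.iInter fun i =>
        MeasurableSet.iInter fun j => (measurableSet_eq_fun (measurable_transition hHB α m i j)
          measurable_const).compl)).inter (measurableSet_injective_energies hHB α (m + 1)).compl
    have hk : (Sum.inr m : ℕ ⊕ ℕ) ∉ (Finset.range (m + 1)).disjSum (Finset.range m) := by simp
    have hnull : P {ω | (fun i => X i ω) ∈ A} = 0 := by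
      refine le_antisymm (measure_le_of_forall_measure_update_le hX hind hk hA
        (fun w w' h1 h2 hw => ?_) fun w => ?_) zero_le
      · have hl : ∀ i < m + 1, w (Sum.inl i) = w' (Sum.inl i) := fun i hi =>
          h1 _ (by simpa using hi)
        have hr : ∀ i < m + 1, w (Sum.inr i) = w' (Sum.inr i) := by
          intro i hi
          rcases Nat.lt_succ_iff_lt_or_eq.mp hi with h | rfl
          · exact h1 _ (by simpa using h)
          · exact h2
        have hc : energies hHB α m w = energies hHB α m w' := energies_congr hHB α
          (fun i hi => hl i (by omega)) (fun i hi => hr i (by omega))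
        have hc' : energies hHB α (m + 1) w = energies hHB α (m + 1) w' :=
          energies_congr hHB α hl hr
        simpa only [A, Set.mem_inter_iff, Set.mem_iInter, Set.mem_compl_iff, Set.mem_ofPred_eq, hc,
          hc', hl m (by omega)] using hw
      · have hc : ∀ t, energies hHB α m (Function.update w (Sum.inr m) t) = energies hHB α m w :=
          fun t => energies_congr hHB α
            (fun i hi => Function.update_of_ne (by simp) _ _)
            (fun i hi => Function.update_of_ne (by simpa using hi.ne) _ _)
        by_cases hw : Function.Injective (energies hHB α m w) ∧
          ∀ i j, energies hHB α m w i - energies hHB α m w j + 2 * w (Sum.inl m) ≠ 0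
        · obtain ⟨e, he⟩ := exists_equiv_energies_update hHB α m w
          obtain ⟨p, -, hp⟩ := exists_energies_discriminant_polynomial hHB α m w
          have hiff : ∀ t : ℝ, p.eval (t : ℂ) ≠ 0 ↔ Function.Injective
              (energies hHB α (m + 1) (Function.update w (Sum.inr m) t)) := fun t => by
            rw [← norm_ne_zero_iff, hp, prod_compl_abs_sub_ne_zero_iff]
          have hpne : p ≠ 0 := by
            rintro rfl
            exact (hiff 0).mpr (injective_of_split hw.1 e he hw.2) (by simp)
          have hsub : {t | Function.update w (Sum.inr m) t ∈ A} ⊆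
              ↑(p.roots.toFinset.image Complex.re) := by
            intro t ht
            have h1 : p.eval (t : ℂ) = 0 := by
              by_contra h
              exact ht.2 ((hiff t).mp h)
            simp only [Finset.coe_image, Set.mem_image, Finset.mem_coe, Multiset.mem_toFinset]
            exact ⟨t, (Polynomial.mem_roots hpne).mpr h1, rfl⟩
          rw [hlaw]
          exact ((measure_mono hsub).trans (Measure.restrict_apply_le _ _)).trans
            (le_of_eq ((Finset.finite_toSet _).measure_zero _))
        · have hempty : {t | Function.update w (Sum.inr m) t ∈ A} = ∅ := by
            rw [Set.eq_empty_iff_forall_notMem]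
            intro t ht
            refine hw ⟨?_, fun i j h => ?_⟩
            · have := ht.1.1
              change Function.Injective _ at this
              rwa [hc] at this
            · refine Set.mem_iInter.mp (Set.mem_iInter.mp ht.1.2 i) j ?_
              change _ = _
              rw [hc, Function.update_of_ne (by simp)]
              exact h
          rw [hempty, measure_empty]
    filter_upwards [ih, ae_transition_ne_zero hHB α hX hind hlaw m, compl_mem_ae_iff.mpr hnull]
      with ω h1 h2 h3
    by_contra h4
    refine h3 ⟨⟨h1, ?_⟩, h4⟩
    exact Set.mem_iInter.mpr fun i => Set.mem_iInter.mpr fun j => h2 i j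

theorem volume_abs_add_two_mul_lt_le (c δ : ℝ) :
    volume {t : ℝ | |c + 2 * t| < δ} ≤ ENNReal.ofReal δ := by
  have hsub : {t : ℝ | |c + 2 * t| < δ} ⊆ Set.Ioo ((-δ - c) / 2) ((δ - c) / 2) := by
    intro t ht
    have := abs_lt.mp (show |c + 2 * t| < δ from ht)
    constructor <;> linarith
  refine (measure_mono hsub).trans ?_
  rw [Real.volume_Ioo]
  exact le_of_eq (congrArg _ (by ring))

/-- For each of the 4^n ordered pairs of levels the bad fields form an interval of length 8^(-n),
where n = `nB + m`. -/
theorem measure_not_nonResonant_le (hX : ∀ k, Measurable (X k)) (hind : iIndepFun X P)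
    (hlaw : ∀ k, P.map (X k) = volume.restrict (Set.Icc (-1 / 2 : ℝ) (1 / 2))) (m : ℕ) :
    P {ω | ¬ NonResonant hHB α m fun k => X k ω} ≤ ENNReal.ofReal ((1 / 2) ^ (nB + m)) := by
  have hk : (Sum.inl m : ℕ ⊕ ℕ) ∉ (Finset.range m).disjSum (Finset.range m) := by simp
  refine measure_le_of_forall_measure_update_le hX hind hk
    (measurableSet_nonResonant hHB α m).compl (fun w w' h1 h2 hw hw' => hw ?_) fun w => ?_
  · refine nonResonant_congr hHB α (fun i hi => ?_) (fun i hi => ?_) hw'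
    · rcases Nat.lt_succ_iff_lt_or_eq.mp hi with h | rfl
      · exact (h1 _ (by simpa using h)).symm
      · exact h2.symm
    · exact (h1 _ (by simpa using hi)).symm
  · have hc : ∀ t, energies hHB α m (Function.update w (Sum.inl m) t) = energies hHB α m w :=
      fun t => energies_congr hHB α
        (fun i hi => Function.update_of_ne (by simpa using hi.ne) _ _)
        (fun i hi => Function.update_of_ne (by simp) _ _)
    have hsub : {t | Function.update w (Sum.inl m) t ∈ {w | NonResonant hHB α m w}ᶜ} ⊆
        ⋃ x : Fin (2 ^ (nB + m)) × Fin (2 ^ (nB + m)),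
          {t | |(energies hHB α m w x.1 - energies hHB α m w x.2) + 2 * t| <
            (1 / 8 : ℝ) ^ (nB + m)} := by
      intro t ht
      have ht' : ¬ NonResonant hHB α m (Function.update w (Sum.inl m) t) := ht
      unfold NonResonant at ht'
      push Not at ht'
      obtain ⟨i, j, hij⟩ := ht'
      rw [hc, Function.update_self] at hij
      exact Set.mem_iUnion.mpr ⟨(i, j), hij⟩
    rw [hlaw]
    refine ((measure_mono hsub).trans (Measure.restrict_apply_le _ _)).trans ?_
    refine (measure_iUnion_fintype_le _ _).trans ?_
    refine (Finset.sum_le_sum fun x _ => volume_abs_add_two_mul_lt_le _ _).trans ?_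
    rw [Finset.sum_const, Finset.card_univ, Fintype.card_prod, Fintype.card_fin, nsmul_eq_mul,
      ← ENNReal.ofReal_natCast, ← ENNReal.ofReal_mul (Nat.cast_nonneg _)]
    refine ENNReal.ofReal_le_ofReal (le_of_eq ?_)
    push_cast
    rw [← mul_pow, ← mul_pow]
    norm_num

theorem ae_eventually_nonResonant (hX : ∀ k, Measurable (X k)) (hind : iIndepFun X P)
    (hlaw : ∀ k, P.map (X k) = volume.restrict (Set.Icc (-1 / 2 : ℝ) (1 / 2))) :
    ∀ᵐ ω ∂P, ∀ᶠ m in atTop, NonResonant hHB α m fun k => X k ω := by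
  have hsum : Summable fun m : ℕ => (1 / 2 : ℝ) ^ (nB + m) := by
    simp only [pow_add]
    exact (summable_geometric_of_lt_one (by norm_num) (by norm_num)).mul_left _
  have h := ae_eventually_notMem (μ := P)
    (s := fun m => {ω | ¬ NonResonant hHB α m fun k => X k ω})
    (ne_top_of_le_ne_top hsum.tsum_ofReal_ne_top
      (ENNReal.tsum_le_tsum fun m => measure_not_nonResonant_le hHB α hX hind hlaw m))
  filter_upwards [h] with ω hω
  filter_upwards [hω] with m hm
  exact not_not.mp hm

end AlmostSure

/-! ### Decay of the number of close pairs -/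

section Decay

variable {nB : ℕ} {HB : Op nB} (hHB : HB.IsHermitian)

/-- The parameters without resonances from stage `K` to stage `m`, and with a bounded cost at
stage `K`. -/
def Regular (α a : ℝ) (K : ℕ) (B : ℝ) (m : ℕ) (w : ℕ ⊕ ℕ → ℝ) : Prop :=
  closeCost (energies hHB α K w) (a ^ (nB + K)) ≤ B ∧
    ∀ k, K ≤ k → k < m → NonResonant hHB α k w

variable {hHB}

theorem Regular.of_succ {α a : ℝ} {K : ℕ} {B : ℝ} {m : ℕ} {w : ℕ ⊕ ℕ → ℝ}
    (h : Regular hHB α a K B (m + 1) w) : Regular hHB α a K B m w :=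
  ⟨h.1, fun k hk hkm => h.2 k hk (by omega)⟩

/-- Regularity up to stage `m + 1` involves the field of the new spin but not its coupling, so the
coupling can be averaged inside the regular event. -/
theorem Regular.update {α a : ℝ} {K : ℕ} {B : ℝ} {m : ℕ} (hKm : K ≤ m) {w : ℕ ⊕ ℕ → ℝ} {s t : ℝ}
    (h : Regular hHB α a K B (m + 1) (Function.update w (Sum.inr m) s)) :
    Regular hHB α a K B (m + 1) (Function.update w (Sum.inr m) t) := by
  have hr : ∀ i < m, Function.update w (Sum.inr m) s (Sum.inr i) =
      Function.update w (Sum.inr m) t (Sum.inr i) := fun i hi => by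
    have : (Sum.inr i : ℕ ⊕ ℕ) ≠ Sum.inr m := by simpa using hi.ne
    rw [Function.update_of_ne this, Function.update_of_ne this]
  have hl : ∀ i, Function.update w (Sum.inr m) s (Sum.inl i) =
      Function.update w (Sum.inr m) t (Sum.inl i) := fun i => by simp
  refine ⟨?_, fun k hk hkm => ?_⟩
  · rw [← energies_congr hHB α (fun i _ => hl i) fun i hi => hr i (by omega)]
    exact h.1
  · exact nonResonant_congr hHB α (fun i _ => hl i) (fun i hi => hr i (by omega)) (h.2 k hk hkm)

variable (hHB)

theorem measurable_closeCost_energies (α ε : ℝ) (m : ℕ) :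
    Measurable fun w => closeCost (energies hHB α m w) ε := by
  simp only [closeCost_eq_sum_filter_ne]
  refine Finset.measurable_sum _ fun p _ => ?_
  have h : Measurable fun w => |energies hHB α m w p.1 - energies hHB α m w p.2| :=
    ((measurable_energies hHB α m p.1).sub (measurable_energies hHB α m p.2)).norm
  exact Measurable.ite (measurableSet_le h measurable_const) h.log.neg measurable_const

theorem measurable_card_closePairs_energies (α ε : ℝ) (m : ℕ) :
    Measurable fun w => ((closePairs (energies hHB α m w) ε).card : ℝ) := by
  unfold closePairs
  simp only [Finset.card_filter, Nat.cast_sum]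
  refine Finset.measurable_sum _ fun p _ => ?_
  have h : Measurable fun w => |energies hHB α m w p.1 - energies hHB α m w p.2| :=
    ((measurable_energies hHB α m p.1).sub (measurable_energies hHB α m p.2)).norm
  by_cases hp : p.1 = p.2
  · simp [hp]
  · simp only [hp, ne_eq, not_false_eq_true, true_and]
    push_cast
    exact Measurable.ite (measurableSet_le h measurable_const) measurable_const measurable_const

theorem measurableSet_regular (α a : ℝ) (K : ℕ) (B : ℝ) (m : ℕ) :
    MeasurableSet {w | Regular hHB α a K B m w} := by
  have h : {w | Regular hHB α a K B m w} =
      {w | closeCost (energies hHB α K w) (a ^ (nB + K)) ≤ B} ∩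
        ⋂ k, ⋂ (_ : K ≤ k), ⋂ (_ : k < m), {w | NonResonant hHB α k w} := by
    ext w
    simp [Regular]
  rw [h]
  refine (measurableSet_le (measurable_closeCost_energies hHB α _ K) measurable_const).inter ?_
  exact MeasurableSet.iInter fun k => MeasurableSet.iInter fun _ => MeasurableSet.iInter fun _ =>
    measurableSet_nonResonant hHB α k

/-- The cost of the close pairs, restricted to the regular parameters. -/
noncomputable def regularCost (α a : ℝ) (K : ℕ) (B : ℝ) (m : ℕ) (w : ℕ ⊕ ℕ → ℝ) : ENNReal :=
  {w | Regular hHB α a K B m w}.indicator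
    (fun w => ENNReal.ofReal (closeCost (energies hHB α m w) (a ^ (nB + m)))) w

/-- The density of close pairs, restricted to the regular parameters. -/
noncomputable def regularDensity (α a : ℝ) (K : ℕ) (B : ℝ) (m : ℕ) (w : ℕ ⊕ ℕ → ℝ) : ENNReal :=
  {w | Regular hHB α a K B m w}.indicator
    (fun w => ENNReal.ofReal
      ((closePairs (energies hHB α m w) (a ^ (nB + m))).card / 2 ^ (nB + m))) w

theorem measurable_regularCost (α a : ℝ) (K : ℕ) (B : ℝ) (m : ℕ) :
    Measurable (regularCost hHB α a K B m) :=
  (measurable_closeCost_energies hHB α _ m).ennreal_ofReal.indicator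
    (measurableSet_regular hHB α a K B m)

theorem measurable_regularDensity (α a : ℝ) (K : ℕ) (B : ℝ) (m : ℕ) :
    Measurable (regularDensity hHB α a K B m) :=
  ((measurable_card_closePairs_energies hHB α _ m).div_const _).ennreal_ofReal.indicator
    (measurableSet_regular hHB α a K B m)

variable {Ω : Type*} {mΩ : MeasurableSpace Ω} {P : Measure Ω} [IsProbabilityMeasure P]
  {X : ℕ ⊕ ℕ → Ω → ℝ} {a q : ℝ}

theorem lintegral_regularCost_succ_le (hnd : NonDegenerate hHB) (hX : ∀ k, Measurable (X k))
    (hind : iIndepFun X P)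
    (hlaw : ∀ k, P.map (X k) = volume.restrict (Set.Icc (-1 / 2 : ℝ) (1 / 2)))
    (ha0 : 0 < a) (ha : a ≤ 1 / 16) (hq0 : 0 < q) (hq : q ≤ Real.exp (-24)) {K : ℕ} (B : ℝ)
    {m : ℕ} (hn : 1 ≤ nB + m) (hKm : K ≤ m) :
    ∫⁻ ω, regularCost hHB (a * q ^ 6) a K B (m + 1) (fun k => X k ω) ∂P ≤
      ENNReal.ofReal (2 * (1 + 1 / (4 * ((nB + m : ℕ) : ℝ)))) *
        ∫⁻ ω, regularCost hHB (a * q ^ 6) a K B m (fun k => X k ω) ∂P + 3 := by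
  have hk : (Sum.inr m : ℕ ⊕ ℕ) ∉ (Finset.range (m + 1)).disjSum (Finset.range m) := by simp
  rw [lintegral_eq_lintegral_lintegral_update hX hind hk
    (measurable_regularCost hHB (a * q ^ 6) a K B (m + 1))]
  · rw [← lintegral_const_mul' _ _ ENNReal.ofReal_ne_top]
    have h3 : (3 : ENNReal) = ∫⁻ _ : Ω, 3 ∂P := by simp
    conv_rhs => rw [h3]
    rw [← lintegral_add_right _ measurable_const]
    refine lintegral_mono_ae ?_
    filter_upwards [ae_injective_energies hHB (a * q ^ 6) hnd hX hind hlaw m] with ω hinj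
    set w : ℕ ⊕ ℕ → ℝ := fun k => X k ω
    by_cases hreg : Regular hHB (a * q ^ 6) a K B (m + 1) w
    · have h1 := lintegral_closeCost_succ_le hHB ha0 ha hq0 hq hn (hreg.2 m hKm (by omega)) hinj
      have h2 : regularCost hHB (a * q ^ 6) a K B m w =
          ENNReal.ofReal (closeCost (energies hHB (a * q ^ 6) m w) (a ^ (nB + m))) :=
        Set.indicator_of_mem (show w ∈ {w | Regular hHB (a * q ^ 6) a K B m w} from hreg.of_succ) _
      rw [hlaw, h2, ← ENNReal.ofReal_mul (by positivity)]
      refine (lintegral_mono fun t => Set.indicator_le_self _ _ _).trans (h1.trans ?_)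
      refine ENNReal.ofReal_add_le.trans ?_
      rw [ENNReal.ofReal_ofNat]
    · have h0 : ∀ t, regularCost hHB (a * q ^ 6) a K B (m + 1)
          (Function.update w (Sum.inr m) t) = 0 := by
        intro t
        refine Set.indicator_of_notMem (fun ht => hreg ?_) _
        have := Regular.update hKm (t := w (Sum.inr m)) ht
        rwa [Function.update_eq_self] at this
      simp only [h0, lintegral_zero]
      exact zero_le
  · intro w w' h1 h2
    have hl : ∀ i < m + 1, w (Sum.inl i) = w' (Sum.inl i) := fun i hi =>
      h1 _ (by simpa using hi)
    have hr : ∀ i < m + 1, w (Sum.inr i) = w' (Sum.inr i) := by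
      intro i hi
      rcases Nat.lt_succ_iff_lt_or_eq.mp hi with h | rfl
      · exact h1 _ (by simpa using h)
      · exact h2
    have hc : ∀ k ≤ m + 1, energies hHB (a * q ^ 6) k w = energies hHB (a * q ^ 6) k w' :=
      fun k hk => energies_congr hHB _ (fun i hi => hl i (by omega)) fun i hi => hr i (by omega)
    have hreg : Regular hHB (a * q ^ 6) a K B (m + 1) w ↔
        Regular hHB (a * q ^ 6) a K B (m + 1) w' := by
      unfold Regular
      rw [hc K (by omega)]
      refine and_congr_right fun _ => forall_congr' fun k => imp_congr_right fun _ =>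
        forall_congr' fun hkm => ⟨nonResonant_congr hHB _ (fun i hi => hl i (by omega))
          fun i hi => hr i (by omega), nonResonant_congr hHB _ (fun i hi => (hl i (by omega)).symm)
          fun i hi => (hr i (by omega)).symm⟩
    unfold regularCost
    by_cases hw : Regular hHB (a * q ^ 6) a K B (m + 1) w
    · rw [Set.indicator_of_mem (show w ∈ {w | Regular hHB (a * q ^ 6) a K B (m + 1) w} from
           hw),
        Set.indicator_of_mem (show w' ∈ {w | Regular hHB (a * q ^ 6) a K B (m + 1) w} from
           hreg.mp hw), hc _ le_rfl]
    · rw [Set.indicator_of_notMem (show w ∉ {w | Regular hHB (a * q ^ 6) a K B (m + 1) w} from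
           hw),
        Set.indicator_of_notMem (show w' ∉ {w | Regular hHB (a * q ^ 6) a K B (m + 1) w} from
           fun h => hw (hreg.mpr h))]

/-- The square of (1 + 1/(4x))√x is x + 1/2 + 1/(16x) ≤ x + 1, so the square root dominates the
product of the relative increases. The offset -3 at least doubles and thereby absorbs the additive
3. -/
theorem growth_step {x c : ℝ} (hx : 1 ≤ x) (hc : 0 ≤ c) {N : ℝ} (hN : 0 ≤ N) :
    2 * (1 + 1 / (4 * x)) * (N * Real.sqrt x * c - 3) + 3 ≤
      2 * N * Real.sqrt (x + 1) * c - 3 := by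
  have h1 : (1 + 1 / (4 * x)) * Real.sqrt x ≤ Real.sqrt (x + 1) := by
    refine Real.le_sqrt_of_sq_le ?_
    rw [mul_pow, Real.sq_sqrt (by linarith)]
    have : (1 + 1 / (4 * x)) ^ 2 * x = x + 1 / 2 + 1 / (16 * x) := by
      field_simp
      ring
    rw [this]
    have : 1 / (16 * x) ≤ 1 / 2 := by
      rw [div_le_div_iff₀ (by linarith) (by norm_num)]
      linarith
    linarith
  have h2 := mul_le_mul_of_nonneg_left h1 (mul_nonneg hN hc)
  have h3 : 0 ≤ 1 / (4 * x) := by positivity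
  nlinarith

theorem lintegral_regularCost_le (hnd : NonDegenerate hHB) (hX : ∀ k, Measurable (X k))
    (hind : iIndepFun X P)
    (hlaw : ∀ k, P.map (X k) = volume.restrict (Set.Icc (-1 / 2 : ℝ) (1 / 2)))
    (ha0 : 0 < a) (ha : a ≤ 1 / 16) (hq0 : 0 < q) (hq : q ≤ Real.exp (-24)) {K : ℕ} {B : ℝ}
    (hB : 0 ≤ B) (hn : 1 ≤ nB + K) {m : ℕ} (hKm : K ≤ m) :
    ∫⁻ ω, regularCost hHB (a * q ^ 6) a K B m (fun k => X k ω) ∂P ≤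
      ENNReal.ofReal (2 ^ (nB + m) * Real.sqrt ((nB + m : ℕ) : ℝ) * (B + 3) - 3) := by
  induction m, hKm using Nat.le_induction with
  | base =>
    have h1 : ∀ ω, regularCost hHB (a * q ^ 6) a K B K (fun k => X k ω) ≤ ENNReal.ofReal B := by
      intro ω
      refine Set.indicator_apply_le' (fun h => ?_) fun _ => zero_le
      exact ENNReal.ofReal_le_ofReal h.1
    refine (lintegral_mono h1).trans ?_
    rw [lintegral_const, measure_univ, mul_one]
    refine ENNReal.ofReal_le_ofReal ?_
    have h2 : (1 : ℝ) ≤ 2 ^ (nB + K) := one_le_pow₀ (by norm_num)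
    have h3 : (1 : ℝ) ≤ Real.sqrt ((nB + K : ℕ) : ℝ) := by
      rw [Real.one_le_sqrt]
      exact_mod_cast hn
    have h4 : 1 ≤ 2 ^ (nB + K) * Real.sqrt ((nB + K : ℕ) : ℝ) := one_le_mul_of_one_le_of_one_le h2 h3
    nlinarith
  | succ m hKm ih =>
    refine (lintegral_regularCost_succ_le hHB hnd hX hind hlaw ha0 ha hq0 hq B (by omega)
      hKm).trans ?_
    have hx : (1 : ℝ) ≤ ((nB + m : ℕ) : ℝ) := by
      have : 1 ≤ nB + m := by omega
      exact_mod_cast this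
    have h2 : (1 : ℝ) ≤ 2 ^ (nB + m) := one_le_pow₀ (by norm_num)
    have h3 : (1 : ℝ) ≤ Real.sqrt ((nB + m : ℕ) : ℝ) := Real.one_le_sqrt.mpr hx
    have h4 : 1 ≤ 2 ^ (nB + m) * Real.sqrt ((nB + m : ℕ) : ℝ) := one_le_mul_of_one_le_of_one_le h2 h3
    have h5 : 0 ≤ 2 ^ (nB + m) * Real.sqrt ((nB + m : ℕ) : ℝ) * (B + 3) - 3 := by nlinarith
    calc _ ≤ ENNReal.ofReal (2 * (1 + 1 / (4 * ((nB + m : ℕ) : ℝ)))) *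
          ENNReal.ofReal (2 ^ (nB + m) * Real.sqrt ((nB + m : ℕ) : ℝ) * (B + 3) - 3) + 3 := by
            gcongr
      _ = ENNReal.ofReal (2 * (1 + 1 / (4 * ((nB + m : ℕ) : ℝ))) *
          (2 ^ (nB + m) * Real.sqrt ((nB + m : ℕ) : ℝ) * (B + 3) - 3) + 3) := by
            rw [← ENNReal.ofReal_mul (by positivity),
              ENNReal.ofReal_add (mul_nonneg (by positivity) h5) (by norm_num),
              ENNReal.ofReal_ofNat]
      _ ≤ _ := by
            refine ENNReal.ofReal_le_ofReal ((growth_step hx (by linarith) (by positivity)).trans ?_)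
            rw [← add_assoc nB m 1, pow_succ' 2 (nB + m)]
            push_cast
            exact le_rfl

/-- A close pair costs at least -log(a^n) ≥ n, which beats the factor √n in the mean cost. -/
theorem lintegral_regularDensity_le (hnd : NonDegenerate hHB) (hX : ∀ k, Measurable (X k))
    (hind : iIndepFun X P)
    (hlaw : ∀ k, P.map (X k) = volume.restrict (Set.Icc (-1 / 2 : ℝ) (1 / 2)))
    (ha0 : 0 < a) (ha : a ≤ 1 / 16) (hq0 : 0 < q) (hq : q ≤ Real.exp (-24)) {K : ℕ} {B : ℝ}
    (hB : 0 ≤ B) (hn : 1 ≤ nB + K) {m : ℕ} (hKm : K ≤ m) :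
    ∫⁻ ω, regularDensity hHB (a * q ^ 6) a K B m (fun k => X k ω) ∂P ≤
      ENNReal.ofReal ((B + 3) / Real.sqrt ((nB + m : ℕ) : ℝ)) := by
  have hx : (1 : ℝ) ≤ ((nB + m : ℕ) : ℝ) := by
    have : 1 ≤ nB + m := by omega
    exact_mod_cast this
  have hlog : 1 ≤ -Real.log a := by
    have h1 := Real.log_le_log ha0 (ha.trans (show (1 / 16 : ℝ) ≤ Real.exp (-1) by
      rw [Real.exp_neg, one_div]
      exact inv_anti₀ (Real.exp_pos _) (by linarith [Real.exp_one_lt_d9])))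
    rw [Real.log_exp] at h1
    linarith
  set x : ℝ := ((nB + m : ℕ) : ℝ) with hxdef
  have hle : ∀ᵐ ω ∂P, regularDensity hHB (a * q ^ 6) a K B m (fun k => X k ω) ≤
      ENNReal.ofReal (1 / (2 ^ (nB + m) * x)) *
        regularCost hHB (a * q ^ 6) a K B m (fun k => X k ω) := by
    filter_upwards [ae_injective_energies hHB (a * q ^ 6) hnd hX hind hlaw m] with ω hinj
    refine Set.indicator_apply_le' (fun h => ?_) fun _ => zero_le
    have h2 : regularCost hHB (a * q ^ 6) a K B m (fun k => X k ω) = ENNReal.ofReal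
        (closeCost (energies hHB (a * q ^ 6) m fun k => X k ω) (a ^ (nB + m))) :=
      Set.indicator_of_mem h _
    rw [h2, ← ENNReal.ofReal_mul (by positivity)]
    refine ENNReal.ofReal_le_ofReal ?_
    have h3 := card_closePairs_mul_le_closeCost hinj (a ^ (nB + m))
    rw [Real.log_pow, ← hxdef] at h3
    rw [one_div, inv_mul_eq_div, ← div_div, div_right_comm]
    refine div_le_div_of_nonneg_right ?_ (by positivity)
    rw [le_div_iff₀ (by linarith)]
    refine le_trans ?_ h3
    refine mul_le_mul_of_nonneg_left ?_ (Nat.cast_nonneg _)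
    nlinarith
  refine (lintegral_mono_ae hle).trans ?_
  rw [lintegral_const_mul' _ _ ENNReal.ofReal_ne_top]
  refine (mul_le_mul_right (lintegral_regularCost_le hHB hnd hX hind hlaw ha0 ha hq0 hq hB hn hKm)
    _).trans ?_
  rw [← ENNReal.ofReal_mul (by positivity)]
  refine ENNReal.ofReal_le_ofReal ?_
  have hs : Real.sqrt x * Real.sqrt x = x := Real.mul_self_sqrt (by linarith)
  have hs0 : 0 < Real.sqrt x := Real.sqrt_pos.mpr (by linarith)
  have h2 : (0 : ℝ) < 2 ^ (nB + m) := by positivity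
  calc 1 / (2 ^ (nB + m) * x) * (2 ^ (nB + m) * Real.sqrt x * (B + 3) - 3)
      ≤ 1 / (2 ^ (nB + m) * x) * (2 ^ (nB + m) * Real.sqrt x * (B + 3)) := by
        gcongr
        linarith
    _ = (B + 3) / Real.sqrt x := by
        rw [div_mul_eq_mul_div, one_mul, div_eq_div_iff (by positivity) hs0.ne']
        linear_combination 2 ^ (nB + m) * (B + 3) * hs

theorem regularDensity_succ_le (ha0 : 0 < a) (ha : a ≤ 1 / 16) (hq0 : 0 < q)
    (hq : q ≤ Real.exp (-24)) {K : ℕ} (B : ℝ) {m : ℕ} (hn : 1 ≤ nB + m) (hKm : K ≤ m)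
    {w : ℕ ⊕ ℕ → ℝ} (hg : |w (Sum.inr m)| ≤ 1 / 2) :
    regularDensity hHB (a * q ^ 6) a K B (m + 1) w ≤ regularDensity hHB (a * q ^ 6) a K B m w := by
  refine Set.indicator_apply_le' (fun h => ?_) fun _ => zero_le
  have hreg : Regular hHB (a * q ^ 6) a K B (m + 1) w := h
  have h2 : regularDensity hHB (a * q ^ 6) a K B m w = ENNReal.ofReal
      ((closePairs (energies hHB (a * q ^ 6) m w) (a ^ (nB + m))).card / 2 ^ (nB + m)) :=
    Set.indicator_of_mem (show w ∈ {w | Regular hHB (a * q ^ 6) a K B m w} from hreg.of_succ) _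
  rw [h2]
  refine ENNReal.ofReal_le_ofReal ?_
  have h3 := card_closePairs_succ_le hHB ha0 ha hq0 hq hn (hreg.2 m hKm (by omega)) hg
  have h4 : ((closePairs (energies hHB (a * q ^ 6) (m + 1) w) (a ^ (nB + (m + 1)))).card : ℝ) ≤
      2 * (closePairs (energies hHB (a * q ^ 6) m w) (a ^ (nB + m))).card := by exact_mod_cast h3
  have h6 : (2 : ℝ) ^ (nB + (m + 1)) = 2 ^ (nB + m) * 2 := by rw [← add_assoc, pow_succ]
  rw [h6, div_le_div_iff₀ (by positivity) (by positivity)]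
  have h5 : (0 : ℝ) < 2 ^ (nB + m) := by positivity
  nlinarith

theorem ae_tendsto_regularDensity (hnd : NonDegenerate hHB) (hX : ∀ k, Measurable (X k))
    (hind : iIndepFun X P)
    (hlaw : ∀ k, P.map (X k) = volume.restrict (Set.Icc (-1 / 2 : ℝ) (1 / 2)))
    (ha0 : 0 < a) (ha : a ≤ 1 / 16) (hq0 : 0 < q) (hq : q ≤ Real.exp (-24)) {K : ℕ} {B : ℝ}
    (hB : 0 ≤ B) (hn : 1 ≤ nB + K) :
    ∀ᵐ ω ∂P, Tendsto (fun m => regularDensity hHB (a * q ^ 6) a K B m fun k => X k ω)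
      atTop (𝓝 0) := by
  have hW : Measurable fun ω k => X k ω := measurable_pi_lambda _ hX
  -- The infimum over the stages has mean zero. By monotonicity it is also the limit, which spares
  -- any summability of the means.
  have hzero : ∫⁻ ω, ⨅ j, regularDensity hHB (a * q ^ 6) a K B (K + j) (fun k => X k ω) ∂P = 0 := by
    refine le_antisymm (ge_of_tendsto (x := atTop) (f := fun j : ℕ =>
      ENNReal.ofReal ((B + 3) / Real.sqrt ((nB + (K + j) : ℕ) : ℝ))) ?_
      (Eventually.of_forall fun j => ?_)) zero_le
    · rw [← ENNReal.ofReal_zero]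
      refine (ENNReal.continuous_ofReal.tendsto 0).comp ?_
      refine Tendsto.div_atTop tendsto_const_nhds ?_
      refine Real.tendsto_sqrt_atTop.comp (tendsto_natCast_atTop_atTop.comp ?_)
      exact tendsto_atTop_mono (fun j => by rw [id]; omega) tendsto_id
    · exact (lintegral_mono fun ω => iInf_le _ j).trans
        (lintegral_regularDensity_le hHB hnd hX hind hlaw ha0 ha hq0 hq hB hn (by omega))
  have hmeas : Measurable fun ω =>
      ⨅ j, regularDensity hHB (a * q ^ 6) a K B (K + j) (fun k => X k ω) :=
    Measurable.iInf fun j => (measurable_regularDensity hHB _ a K B (K + j)).comp hW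
  rw [lintegral_eq_zero_iff hmeas] at hzero
  have hg : ∀ᵐ ω ∂P, ∀ m, |X (Sum.inr m) ω| ≤ 1 / 2 := by
    rw [ae_all_iff]
    intro m
    refine ae_of_ae_map (hX (Sum.inr m)).aemeasurable (p := fun t => |t| ≤ 1 / 2) ?_
    rw [hlaw]
    filter_upwards [ae_restrict_mem measurableSet_Icc] with t ht
    exact abs_le.mpr ⟨by linarith [ht.1], ht.2⟩
  filter_upwards [hzero, hg] with ω h1 h2
  have hanti : Antitone fun j => regularDensity hHB (a * q ^ 6) a K B (K + j) fun k => X k ω :=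
    antitone_nat_of_succ_le fun j => regularDensity_succ_le hHB ha0 ha hq0 hq B (m := K + j)
      (by omega) (by omega) (h2 _)
  have hlim := tendsto_atTop_iInf hanti
  rw [Pi.zero_apply] at h1
  rw [h1] at hlim
  rw [← tendsto_add_atTop_iff_nat K]
  simpa only [add_comm K] using hlim

theorem ae_tendsto_density_closePairs (hnd : NonDegenerate hHB) (hX : ∀ k, Measurable (X k))
    (hind : iIndepFun X P)
    (hlaw : ∀ k, P.map (X k) = volume.restrict (Set.Icc (-1 / 2 : ℝ) (1 / 2)))
    (ha0 : 0 < a) (ha : a ≤ 1 / 16) (hq0 : 0 < q) (hq : q ≤ Real.exp (-24)) :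
    ∀ᵐ ω ∂P, Tendsto (fun m => ((closePairs (energies hHB (a * q ^ 6) m fun k => X k ω)
      (a ^ (nB + m))).card : ℝ) / 2 ^ (nB + m)) atTop (𝓝 0) := by
  -- Countably many choices of `K` and `B` cover almost every realization. The stage is `K + 1` so
  -- that there is at least one spin even for an empty bath.
  have hall : ∀ᵐ ω ∂P, ∀ K B : ℕ, Tendsto
      (fun m => regularDensity hHB (a * q ^ 6) a (K + 1) B m fun k => X k ω) atTop (𝓝 0) := by
    rw [ae_all_iff]
    intro K
    rw [ae_all_iff]
    intro B
    exact ae_tendsto_regularDensity hHB hnd hX hind hlaw ha0 ha hq0 hq (Nat.cast_nonneg B)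
      (by omega)
  filter_upwards [hall, ae_eventually_nonResonant hHB (a * q ^ 6) hX hind hlaw] with ω h1 h2
  obtain ⟨K, hK⟩ := eventually_atTop.mp h2
  obtain ⟨B, hB⟩ := exists_nat_ge (closeCost (energies hHB (a * q ^ 6) (K + 1) fun k => X k ω)
    (a ^ (nB + (K + 1))))
  have hreg : ∀ m, regularDensity hHB (a * q ^ 6) a (K + 1) B m (fun k => X k ω) =
      ENNReal.ofReal (((closePairs (energies hHB (a * q ^ 6) m fun k => X k ω)
      (a ^ (nB + m))).card : ℝ) / 2 ^ (nB + m)) := fun m =>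
    Set.indicator_of_mem (show (fun k => X k ω) ∈ {w | Regular hHB _ _ _ _ _ w} from
      ⟨hB, fun k hk _ => hK k (by omega)⟩) _
  have h3 := (ENNReal.tendsto_toReal ENNReal.zero_ne_top).comp (h1 K B)
  rw [ENNReal.toReal_zero] at h3
  refine h3.congr fun m => ?_
  rw [Function.comp_apply, hreg, ENNReal.toReal_ofReal (by positivity)]

end Decay

/-! ### Close pairs and resonant patches -/

section Patches

variable {N : ℕ} {E : Fin N → ℝ} {ε : ℝ}

/-- A patch containing `i` and another index would contain a neighbour of `i` on that side, at
distance at most ε. -/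
theorem eq_of_patchSetoid_of_isolated (hE : Monotone E) {i j : Fin N}
    (hi : ∀ j, j ≠ i → ε < |E i - E j|) (h : patchSetoid E ε i j) : j = i := by
  by_contra hne
  rcases lt_or_gt_of_ne hne with hlt | hlt
  · have hj : (j : ℕ) < i := hlt
    let k : Fin N := ⟨(i : ℕ) - 1, by omega⟩
    have hk : (k : ℕ) + 1 = i := by simp only [k]; omega
    have h1 := h k i hk ((min_le_right _ _).trans (Fin.le_def.mpr (by omega))) (le_max_left _ _)
    have hki : k ≤ i := Fin.le_def.mpr (by omega)
    have h2 := hi k fun h => by rw [h] at hk; omega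
    rw [abs_of_nonneg (sub_nonneg.mpr (hE hki))] at h2
    linarith
  · have hj : (i : ℕ) < j := hlt
    let l : Fin N := ⟨(i : ℕ) + 1, by omega⟩
    have hl : (i : ℕ) + 1 = l := rfl
    have h1 := h i l hl (min_le_left _ _) ((Fin.le_def.mpr (by omega)).trans (le_max_right _ _))
    have hil : i ≤ l := Fin.le_def.mpr (by omega)
    have h2 := hi l fun h => by rw [h] at hl; omega
    rw [abs_sub_comm, abs_of_nonneg (sub_nonneg.mpr (hE hil))] at h2
    linarith

theorem singleton_mem_patches (hE : Monotone E) {i : Fin N}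
    (hi : ∀ j, j ≠ i → ε < |E i - E j|) : {i} ∈ patches E ε := by
  classical
  have h : (Finpartition.ofSetoid (patchSetoid E ε)).part i = {i} := by
    ext j
    rw [Finpartition.mem_part_ofSetoid_iff_rel, Finset.mem_singleton]
    constructor
    · exact eq_of_patchSetoid_of_isolated hE hi
    · rintro rfl
      exact (patchSetoid E ε).refl _
  unfold patches
  rw [← h]
  convert (Finpartition.ofSetoid (patchSetoid E ε)).part_mem.mpr (Finset.mem_univ i)

/-- Every index that is not isolated is the first entry of some ordered close pair, and the isolated
ones are singleton patches. -/
theorem sub_card_closePairs_le (hE : Monotone E) :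
    (N : ℝ) - (closePairs E ε).card ≤ (patchesOfSize E ε 1).card := by
  classical
  set S : Finset (Fin N) := (closePairs E ε).image Prod.fst
  have hS : S.card ≤ (closePairs E ε).card := Finset.card_image_le
  have hiso : ∀ i ∈ Sᶜ, {i} ∈ patchesOfSize E ε 1 := by
    intro i hi
    refine Finset.mem_filter.mpr ⟨singleton_mem_patches hE fun j hj => ?_, Finset.card_singleton i⟩
    by_contra! hle
    refine Finset.mem_compl.mp hi (Finset.mem_image.mpr ⟨(i, j), ?_, rfl⟩)
    exact mem_closePairs.mpr ⟨hj.symm, hle⟩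
  have hcard : Sᶜ.card ≤ (patchesOfSize E ε 1).card :=
    Finset.card_le_card_of_injOn (fun i => {i}) hiso fun i _ j _ h => Finset.singleton_injective h
  have hcompl : Sᶜ.card + S.card = N := by
    rw [Finset.card_compl_add_card, Fintype.card_fin]
  have h1 : (N : ℝ) = Sᶜ.card + S.card := by exact_mod_cast hcompl.symm
  have h2 : (S.card : ℝ) ≤ (closePairs E ε).card := by exact_mod_cast hS
  have h3 : (Sᶜ.card : ℝ) ≤ (patchesOfSize E ε 1).card := by exact_mod_cast hcard
  linarith

theorem card_patchesOfSize_le (E : Fin N → ℝ) (ε : ℝ) (k : ℕ) :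
    (patchesOfSize E ε k).card ≤ N := by
  classical
  have h := (Finpartition.ofSetoid (patchSetoid E ε)).card_parts_le_card
  rw [Finset.card_univ, Fintype.card_fin] at h
  refine (Finset.card_filter_le _ _).trans ?_
  unfold patches
  convert h

end Patches

theorem tendsto_card_patchesOfSize_one {nB : ℕ} {E : (m : ℕ) → Fin (2 ^ (nB + m)) → ℝ}
    (hE : ∀ m, Monotone (E m)) {ε : ℕ → ℝ}
    (h : Tendsto (fun m => ((closePairs (E m) (ε m)).card : ℝ) / 2 ^ (nB + m)) atTop (𝓝 0)) :
    Tendsto (fun m => ((patchesOfSize (E m) (ε m) 1).card : ℝ) / 2 ^ (nB + m)) atTop (𝓝 1) := by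
  have h1 : Tendsto (fun m => 1 - ((closePairs (E m) (ε m)).card : ℝ) / 2 ^ (nB + m)) atTop
      (𝓝 1) := by simpa using h.const_sub 1
  refine tendsto_of_tendsto_of_tendsto_of_le_of_le h1 tendsto_const_nhds (fun m => ?_) fun m => ?_
  · have h2 := sub_card_closePairs_le (ε := ε m) (hE m)
    have h3 : (0 : ℝ) < 2 ^ (nB + m) := by positivity
    rw [le_div_iff₀ h3, sub_mul, div_mul_cancel₀ _ h3.ne', one_mul]
    exact_mod_cast h2
  · have h3 : (0 : ℝ) < 2 ^ (nB + m) := by positivity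
    rw [div_le_one h3]
    exact_mod_cast card_patchesOfSize_le (E m) (ε m) 1

end QuantumSun

/-! ### The choice of the exponents and the conclusion -/

theorem theorem3 (θ : ℝ) (hθ : θ ∈ Set.Ioo (2 / 3 : ℝ) 1) :
    ∃ α₀ : ℝ, 0 < α₀ ∧ α₀ < 1 / 2 ∧
      ∀ (nB : ℕ) (HB : QuantumSun.Op nB) (hHB : HB.IsHermitian),
        QuantumSun.NonDegenerate hHB →
      ∀ α : ℝ, 0 ≤ α → α ≤ α₀ →
      ∀ (Ω : Type*) (mΩ : MeasurableSpace Ω) (P : Measure Ω) (_ : IsProbabilityMeasure P)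
        (h g : ℕ → Ω → ℝ),
        (∀ i, Measurable (h i)) → (∀ i, Measurable (g i)) →
        iIndepFun (Sum.elim h g) P →
        (∀ i, pdf.IsUniform (h i) (Set.Icc (-1 / 2 : ℝ) (1 / 2)) P volume) →
        (∀ i, pdf.IsUniform (g i) (Set.Icc (-1 / 2 : ℝ) (1 / 2)) P volume) →
        ∀ᵐ ω ∂P, Tendsto
          (fun m : ℕ =>
            ((QuantumSun.patchesOfSize
                (QuantumSun.levels (QuantumSun.hamiltonian_isHermitian hHB α
                  (fun i => h i ω) (fun i => g i ω) m))
                (α ^ (θ * ((nB + m : ℕ) : ℝ))) 1).card : ℝ) / 2 ^ (nB + m))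
          atTop (𝓝 1) := by
  obtain ⟨hθ1, hθ2⟩ := hθ
  -- This is the solution of θ + 6η = 1, so that `α ^ θ * (α ^ η) ^ 6 = α`. The bound `exp (-24) ^
  -- η⁻¹` on `α` then says exactly that `α ^ η ≤ exp (-24)`.
  set η : ℝ := (1 - θ) / 6 with hη
  have hη0 : 0 < η := by rw [hη]; linarith
  have hη1 : η ≤ 1 := by rw [hη]; linarith
  refine ⟨Real.exp (-24) ^ η⁻¹, by positivity, ?_, ?_⟩
  · have h1 : Real.exp (-24) ^ η⁻¹ ≤ Real.exp (-24) ^ (1 : ℝ) :=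
      Real.rpow_le_rpow_of_exponent_ge (Real.exp_pos _) (Real.exp_le_one_iff.mpr (by norm_num))
        ((one_le_inv₀ hη0).mpr hη1)
    rw [Real.rpow_one] at h1
    linarith [QuantumSun.exp_neg_twentyfour_le]
  intro nB HB hHB hnd α hα0 hα Ω mΩ P hP h g hh hg hind hhu hgu
  have hX : ∀ k, Measurable (Sum.elim h g k) := by
    rintro (k | k)
    · exact hh k
    · exact hg k
  have hunif : ∀ Y : Ω → ℝ, pdf.IsUniform Y (Set.Icc (-1 / 2 : ℝ) (1 / 2)) P volume →
      P.map Y = volume.restrict (Set.Icc (-1 / 2 : ℝ) (1 / 2)) := by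
    intro Y hY
    rw [hY, ProbabilityTheory.cond, Real.volume_Icc]
    norm_num
  have hlaw : ∀ k, P.map (Sum.elim h g k) = volume.restrict (Set.Icc (-1 / 2 : ℝ) (1 / 2)) := by
    rintro (k | k)
    · exact hunif _ (hhu k)
    · exact hunif _ (hgu k)
  have hmain : ∀ᵐ ω ∂P, Tendsto (fun m => ((QuantumSun.closePairs
      (QuantumSun.energies hHB α m fun k => Sum.elim h g k ω)
      (α ^ (θ * ((nB + m : ℕ) : ℝ)))).card : ℝ) / 2 ^ (nB + m)) atTop (𝓝 0) := by
    -- For `α = 0` there is no positive `q`, but the threshold is 0 as soon as there is a spin, and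
    -- simplicity of the spectrum suffices. The case of no spin has to be avoided because of `0 ^ 0
    -- = 1`.
    rcases hα0.eq_or_lt with rfl | hαpos
    · have hinj := ae_all_iff.mpr
        fun m => QuantumSun.ae_injective_energies hHB 0 hnd hX hind hlaw m
      filter_upwards [hinj] with ω hω
      refine tendsto_const_nhds.congr' ?_
      filter_upwards [eventually_ge_atTop 1] with m hm
      have hexp : θ * ((nB + m : ℕ) : ℝ) ≠ 0 := by
        have : (1 : ℝ) ≤ ((nB + m : ℕ) : ℝ) := by
          have : 1 ≤ nB + m := by omega
          exact_mod_cast this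
        nlinarith
      rw [Real.zero_rpow hexp]
      have hempty : QuantumSun.closePairs
          (QuantumSun.energies hHB 0 m fun k => Sum.elim h g k ω) 0 = ∅ := by
        rw [Finset.eq_empty_iff_forall_notMem]
        intro p hp
        obtain ⟨hne, hle⟩ := QuantumSun.mem_closePairs.mp hp
        exact hne (hω m (sub_eq_zero.mp (abs_eq_zero.mp (le_antisymm hle (abs_nonneg _)))))
      rw [hempty]
      simp
    · set a := α ^ θ with ha
      set q := α ^ η with hq
      have haq : a * q ^ 6 = α := by
        rw [ha, hq, ← Real.rpow_natCast, ← Real.rpow_mul hα0, ← Real.rpow_add hαpos]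
        rw [show θ + η * ((6 : ℕ) : ℝ) = 1 by rw [hη]; push_cast; ring, Real.rpow_one]
      have hqle : q ≤ Real.exp (-24) := by
        have h1 := Real.rpow_le_rpow hα0 hα hη0.le
        rwa [← Real.rpow_mul (Real.exp_pos _).le, inv_mul_cancel₀ hη0.ne', Real.rpow_one] at h1
      have hα1 : α ≤ 1 := hα.trans
        (Real.rpow_le_one (Real.exp_pos _).le (Real.exp_le_one_iff.mpr (by norm_num)) (by positivity))
      have hale : a ≤ 1 / 16 := by
        have h1 : a ≤ q := Real.rpow_le_rpow_of_exponent_ge hαpos hα1 (by rw [hη]; linarith)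
        linarith [QuantumSun.exp_neg_twentyfour_le]
      have h1 := QuantumSun.ae_tendsto_density_closePairs hHB hnd hX hind hlaw
        (Real.rpow_pos_of_pos hαpos θ : 0 < a) hale (Real.rpow_pos_of_pos hαpos η : 0 < q) hqle
      rw [haq] at h1
      have hpow : ∀ m : ℕ, α ^ (θ * ((nB + m : ℕ) : ℝ)) = a ^ (nB + m) := fun m =>
        Real.rpow_mul_natCast hα0 θ (nB + m)
      simpa only [hpow] using h1
  filter_upwards [hmain] with ω hω
  exact QuantumSun.tendsto_card_patchesOfSize_one (fun m => QuantumSun.levels_monotone _) hω
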